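/- **Notation.** Let $n\ge 0$, $[n]=\{1,\dots,n\}$, $s_i=(i\ i+1)\in\mathfrak S_n$, $\ell$ the length function of $\mathfrak S_n$, and $w_0$ the longest element. Permutations are identified with their one-line words. The left weak order $\preceq_L$ has covers $\sigma\prec s_i\sigma$ for $i\notin \mathrm{Des}_L(\sigma)=\{i:\ell(s_i\sigma)<\ell(\sigma)\}$, the right weak order $\preceq_R$ has covers $\sigma\prec \sigma s_i$ for $i\notin\mathrm{Des}_R(\sigma)=\{i:\ell(\sigma s_i)<\ell(\sigma)\}$; $[\sigma,\rho]_L$, $[\sigma,\rho]_R$ denote their intervals. For $\alpha=(\alpha_1,\dots,\alpha_k)\models n$ let $\mathrm{set}(\alpha)=\{\alpha_1,\alpha_1+\alpha_2,\dots,\alpha_1+\cdots+\alpha_{k-1}\}\subseteq[n-1]$, let $I\mapsto\mathrm{comp}(I)$ be the inverse of $\alpha\mapsto\mathrm{set}(\alpha)$, and $\mathrm{set}(\alpha^{\mathrm c})=[n-1]\setminus\mathrm{set}(\alpha)$. The algebra $H_n(0)$ over $\mathbb C$ is generated by $\pi_1,\dots,\pi_{n-1}$ with $\pi_i^2=\pi_i$,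 $\pi_i\pi_{i+1}\pi_i=\pi_{i+1}\pi_i\pi_{i+1}$ and $\pi_i\pi_j=\pi_j\pi_i$ for $|i-j|\ge2$. For $\sigma\preceq_L\rho$, $\mathsf B_L(\sigma,\rho)$ is the left $H_n(0)$-module $\mathbb C[\sigma,\rho]_L$ in which $\pi_i\cdot\gamma$ is $\gamma$ if $i\in\mathrm{Des}_L(\gamma)$, is $s_i\gamma$ if $i\notin\mathrm{Des}_L(\gamma)$ and $s_i\gamma\in[\sigma,\rho]_L$, and is $0$ otherwise. For a poset $P$ on $[n]$ let $\Sigma_R(P)=\{\gamma\in\mathfrak S_n:\gamma^{-1}(i)<\gamma^{-1}(j)\text{ whenever } i\prec_P j\}$. For an $n$-element set $D$ of boxes $(x,y)$ with $x,y\ge 1$ and no empty rows or columns (the occupied columns $x$ are $1,\dots,l$ and the occupied rows $y$ are $1,\dots,k$ for some $k,l$), $P_D$ is the poset on $[n]$ with $i\preceq j$ iff $x_i\le x_j$ and $y_i\le y_j$, where $(x_1,y_1),\dots,(x_n,y_n)$ lists $D$ row by row from the top row (largest $y$) down, each row from left to right. For $\alpha\models n$ and $\rho\in\mathfrak S_n$,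 let $\mathrm{set}(\alpha^{\mathrm c})=\{z_1<\dots<z_l\}$, $\mathrm{Des}_L(\rho)=\{k_1<\dots<k_e\}$, $z_0=k_0=0$, $z_{l+1}=k_{e+1}=n$, and $$D_{\alpha;\rho}=\{(i,j):\ 1\le i\le e+1,\ 1\le j\le l+1,\ \{\rho(r):z_{j-1}<r\le z_j\}\cap\{c:k_{i-1}<c\le k_i\}\ne\emptyset\}.$$ A standard reverse composition tableau (SRCT) of shape $\alpha\models n$ is a bijective filling $\tau$, with entries $1,\dots,n$, of the left-justified diagram with $\alpha_i$ boxes in the $i$th row from the top, such that rows decrease from left to right, the first column increases from top to bottom, and whenever $i<j$ and $\tau_{i,k}>\tau_{j,k+1}$, the box $(i,k+1)$ is in the diagram and $\tau_{i,k+1}>\tau_{j,k+1}$. An index $i\in[n-1]$ is a descent of $\tau$ ($i\in\mathrm{Des}(\tau)$) if $i+1$ lies weakly right of $i$; a descent $i$ is attacking if $i$ and $i+1$ are in the same column, or $i+1$ is in the next column to the right and strictly below $i$. Two SRCTs of shape $\alpha$ are equivalent if, in every column, the relative order of the entries is the same. The space $\mathbf S_\alpha$ spanned by the SRCTs of shape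 $\alpha$ is an $H_n(0)$-module by: $\pi_i\cdot\tau$ is $\tau$ if $i\notin\mathrm{Des}(\tau)$, is $0$ if $i$ is an attacking descent, and is $\tau$ with $i,i+1$ exchanged if $i$ is a nonattacking descent. For an equivalence class $E$, $\mathbf S_{\alpha,E}$ is the submodule spanned by $E$. A source tableau is an SRCT in which, for every $i\in[n-1]\setminus\mathrm{Des}(\tau)$, $i+1$ is immediately left of $i$; a sink tableau is one all of whose descents are attacking. **Theorem.** Let $\alpha\models n$ and let $E$ be an equivalence class of SRCTs of shape $\alpha$. Then $E$ contains exactly one source tableau $\tau_E$ and exactly one sink tableau $\tau'_E$. Let $\mathrm{Des}(\tau_E)=\{d_1<\dots<d_m\}$, $d_0=0$, $d_{m+1}=n$. For $\tau\in E$, let $\mathtt{read}(\tau)$ be the concatenation, for $j=1,\dots,m+1$, of the words obtained by reading from left to right the entries of $\tau$ in the boxes that are occupied in $\tau_E$ by $d_{j-1}+1,\dots,d_j$. Put $\sigma=\mathtt{read}(\tau_E)$ and $\rho=\mathtt{read}(\tau'_E)$. Then $\sigma\preceq_L\rho$ and $\mathbf S_{\alpha,E}\cong\mathsf B_L(\sigma,\rho)$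 as $H_n(0)$-modules; the set $D=D_{\mathrm{comp}(\mathrm{Des}(\tau_E)^{\mathrm c});\,\rho}$ has exactly $n$ elements and no empty rows or columns; and the poset $P_{\mathbf S_{\alpha,E}}$ attached to $\mathbf S_{\alpha,E}$, that is, the unique poset $P$ on $[n]$ with $\Sigma_R(P)=[w_0\rho^{-1},w_0\sigma^{-1}]_R$, is $$P_{\mathbf S_{\alpha,E}}=P_{D_{\mathrm{comp}(\mathrm{Des}(\tau_E)^{\mathrm c});\,\mathtt{read}(\tau'_E)}}.$$ -/

import Mathlib

/-! Throughout, the letters `1, …, n` are represented by `Fin n` (so the letter `v` of the usual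
notation is the element with value `v - 1`), and the set `[n-1]` indexing simple transpositions,
generators and descents is represented by `Fin (n - 1)` (so `i : Fin (n - 1)` stands for the usual
index `i + 1`). -/

namespace HeckePoset

open scoped Classical

variable {n : ℕ}

/-! ### The symmetric group -/

/-- The smaller of the two letters exchanged by the simple transposition with index `i`. -/
def lo (i : Fin (n - 1)) : Fin n := ⟨i.1, by omega⟩

/-- The larger of the two letters exchanged by the simple transposition with index `i`. -/
def hi (i : Fin (n - 1)) : Fin n := ⟨i.1 + 1, by omega⟩

/-- The simple transposition with index `i`. -/
def s (i : Fin (n - 1)) : Equiv.Perm (Fin n) := Equiv.swap (lo i) (hi i)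

/-- The length of a permutation: the minimal number of simple transpositions in an expression. -/
noncomputable def length (σ : Equiv.Perm (Fin n)) : ℕ :=
  sInf {k | ∃ l : List (Fin (n - 1)), l.length = k ∧ (l.map s).prod = σ}

/-- The left descent set. -/
noncomputable def desL (σ : Equiv.Perm (Fin n)) : Finset (Fin (n - 1)) :=
  Finset.univ.filter fun i => length (s i * σ) < length σ

/-- The right descent set. -/
noncomputable def desR (σ : Equiv.Perm (Fin n)) : Finset (Fin (n - 1)) :=
  Finset.univ.filter fun i => length (σ * s i) < length σ

/-- The left weak Bruhat order, generated by the covers `σ ⋖ s i * σ` for `i ∉ desL σ`. -/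
def LeftWeakLE : Equiv.Perm (Fin n) → Equiv.Perm (Fin n) → Prop :=
  Relation.ReflTransGen fun σ ρ => ∃ i, i ∉ desL σ ∧ ρ = s i * σ

/-- The right weak Bruhat order, generated by the covers `σ ⋖ σ * s i` for `i ∉ desR σ`. -/
def RightWeakLE : Equiv.Perm (Fin n) → Equiv.Perm (Fin n) → Prop :=
  Relation.ReflTransGen fun σ ρ => ∃ i, i ∉ desR σ ∧ ρ = σ * s i

/-- The left weak Bruhat interval `[σ, ρ]_L`. -/
def leftInterval (σ ρ : Equiv.Perm (Fin n)) : Set (Equiv.Perm (Fin n)) :=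
  {γ | LeftWeakLE σ γ ∧ LeftWeakLE γ ρ}

/-- The right weak Bruhat interval `[σ, ρ]_R`. -/
def rightInterval (σ ρ : Equiv.Perm (Fin n)) : Set (Equiv.Perm (Fin n)) :=
  {γ | RightWeakLE σ γ ∧ RightWeakLE γ ρ}

/-- The longest element `w₀` of the symmetric group, i.e. the word `n (n-1) … 1`. -/
def w0 : Equiv.Perm (Fin n) := Fin.revPerm

/-! Left descents can be read off from the one-line notation. -/

theorem lo_lt_hi (i : Fin (n - 1)) : lo i < hi i := by
  simp [lo, hi]

theorem s_s (i : Fin (n - 1)) (v : Fin n) : s i (s i v) = v := by simp [s]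

theorem s_mul_s (i : Fin (n - 1)) : s i * s i = 1 := by
  ext v; simp [s_s]

theorem s_inv (i : Fin (n - 1)) : (s i)⁻¹ = s i := by simp [s]

theorem s_lo (i : Fin (n - 1)) : s i (lo i) = hi i := by simp [s]

theorem s_hi (i : Fin (n - 1)) : s i (hi i) = lo i := by simp [s]

theorem s_apply_val (i : Fin (n - 1)) (v : Fin n) :
    (s i v).1 = if v.1 = i.1 then i.1 + 1 else if v.1 = i.1 + 1 then i.1 else v.1 := by
  simp only [s, Equiv.swap_apply_def, lo, hi, Fin.ext_iff]
  split_ifs <;> simp_all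

/-- The set of inverted pairs of positions. -/
def invSet (σ : Equiv.Perm (Fin n)) : Finset (Fin n × Fin n) :=
  Finset.univ.filter fun p => p.1 < p.2 ∧ σ p.2 < σ p.1

theorem mem_invSet (σ : Equiv.Perm (Fin n)) (a b : Fin n) :
    (a, b) ∈ invSet σ ↔ a < b ∧ σ b < σ a := by
  simp [invSet]

theorem invSet_s_mul (σ : Equiv.Perm (Fin n)) (i : Fin (n - 1))
    (h : σ⁻¹ (lo i) < σ⁻¹ (hi i)) :
    (invSet (s i * σ)).card = (invSet σ).card + 1 := by
  have key : invSet (s i * σ) = insert (σ⁻¹ (lo i), σ⁻¹ (hi i)) (invSet σ) := by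
    ext ⟨a, b⟩
    rw [Finset.mem_insert, mem_invSet, mem_invSet, Prod.mk.injEq, Equiv.Perm.mul_apply,
      Equiv.Perm.mul_apply]
    have ha : a = σ⁻¹ (lo i) ↔ (σ a).1 = i.1 := by
      rw [Equiv.Perm.eq_inv_iff_eq, Fin.ext_iff]; rfl
    have hb : b = σ⁻¹ (hi i) ↔ (σ b).1 = i.1 + 1 := by
      rw [Equiv.Perm.eq_inv_iff_eq, Fin.ext_iff]; rfl
    have ha' : a = σ⁻¹ (hi i) ↔ (σ a).1 = i.1 + 1 := by
      rw [Equiv.Perm.eq_inv_iff_eq, Fin.ext_iff]; rfl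
    have hb' : b = σ⁻¹ (lo i) ↔ (σ b).1 = i.1 := by
      rw [Equiv.Perm.eq_inv_iff_eq, Fin.ext_iff]; rfl
    simp only [Fin.lt_def, s_apply_val, ha, hb]
    rw [Fin.lt_def] at h
    have hne : a.1 < b.1 → (σ a).1 ≠ (σ b).1 := by
      intro hab e
      have : a = b := σ.injective (Fin.ext e)
      omega
    have h1 : (σ a).1 = i.1 → (σ b).1 = i.1 + 1 → a.1 < b.1 := by
      intro e1 e2
      rw [ha.2 e1, hb.2 e2]; exact h
    have h2 : (σ a).1 = i.1 + 1 → (σ b).1 = i.1 → b.1 < a.1 := by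
      intro e1 e2
      rw [ha'.2 e1, hb'.2 e2]; exact h
    split_ifs <;> omega
  rw [key, Finset.card_insert_of_notMem]
  rw [mem_invSet]
  simp [(lo_lt_hi i).le]

theorem invSet_s_mul' (σ : Equiv.Perm (Fin n)) (i : Fin (n - 1))
    (h : σ⁻¹ (hi i) < σ⁻¹ (lo i)) :
    (invSet (s i * σ)).card + 1 = (invSet σ).card := by
  have := invSet_s_mul (s i * σ) i (by simpa [mul_inv_rev, s_inv, s_lo, s_hi] using h)
  rw [← mul_assoc, s_mul_s, one_mul] at this
  exact this.symm

theorem inv_lo_ne (σ : Equiv.Perm (Fin n)) (i : Fin (n - 1)) : σ⁻¹ (lo i) ≠ σ⁻¹ (hi i) := by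
  intro h
  exact (lo_lt_hi i).ne (σ⁻¹.injective h)

theorem invSet_prod_le (l : List (Fin (n - 1))) :
    (invSet (l.map s).prod).card ≤ l.length := by
  induction l with
  | nil => simp [invSet, Finset.filter_eq_empty_iff]; intro a b h; exact h.le
  | cons i l ih =>
    simp only [List.map_cons, List.prod_cons, List.length_cons]
    rcases lt_or_gt_of_ne (inv_lo_ne (l.map s).prod i) with h | h
    · rw [invSet_s_mul _ _ h]; omega
    · have := invSet_s_mul' _ _ h; omega

theorem exists_inv_hi_lt (σ : Equiv.Perm (Fin n)) (h : σ ≠ 1) :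
    ∃ i : Fin (n - 1), σ⁻¹ (hi i) < σ⁻¹ (lo i) := by
  by_contra hc
  push Not at hc
  apply h
  have hmono : StrictMono (σ⁻¹ : Equiv.Perm (Fin n)) := by
    cases n with
    | zero => intro a; exact a.elim0
    | succ m =>
      rw [Fin.strictMono_iff_lt_succ]
      intro i
      exact lt_of_le_of_ne (hc i) (inv_lo_ne σ i)
  have : (σ⁻¹ : Equiv.Perm (Fin n)) = 1 := by
    have h2 := Subsingleton.elim (hmono.orderIsoOfSurjective _ (σ⁻¹).surjective)
      (OrderIso.refl (Fin n))
    ext v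
    have := DFunLike.congr_fun h2 v
    simpa using congrArg Fin.val this
  simpa using this

theorem exists_word (k : ℕ) : ∀ σ : Equiv.Perm (Fin n), (invSet σ).card = k →
    ∃ l : List (Fin (n - 1)), l.length = k ∧ (l.map s).prod = σ := by
  induction k with
  | zero =>
    intro σ hσ
    refine ⟨[], rfl, ?_⟩
    by_contra hne
    obtain ⟨i, hi⟩ := exists_inv_hi_lt σ (by simpa using Ne.symm hne)
    have := invSet_s_mul' _ _ hi
    omega
  | succ k ih =>
    intro σ hσ
    have hne : σ ≠ 1 := by
      rintro rfl
      have := invSet_prod_le (n := n) []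
      simp at this
      simp [this] at hσ
    obtain ⟨i, hi⟩ := exists_inv_hi_lt σ hne
    have := invSet_s_mul' _ _ hi
    obtain ⟨l, hl, hl'⟩ := ih (s i * σ) (by omega)
    refine ⟨i :: l, by simp [hl], ?_⟩
    simp [hl', ← mul_assoc, s_mul_s]

theorem length_eq_card_invSet (σ : Equiv.Perm (Fin n)) : length σ = (invSet σ).card := by
  apply le_antisymm
  · exact Nat.sInf_le (exists_word _ σ rfl)
  · apply le_csInf
    · exact ⟨_, exists_word _ σ rfl⟩
    · rintro k ⟨l, rfl, rfl⟩
      exact invSet_prod_le l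

theorem mem_desL_iff (σ : Equiv.Perm (Fin n)) (i : Fin (n - 1)) :
    i ∈ desL σ ↔ σ⁻¹ (hi i) < σ⁻¹ (lo i) := by
  simp only [desL, Finset.mem_filter, Finset.mem_univ, true_and, length_eq_card_invSet]
  rcases lt_or_gt_of_ne (inv_lo_ne σ i) with h | h
  · rw [invSet_s_mul _ _ h]
    simp only [h.not_gt, iff_false]
    omega
  · have := invSet_s_mul' _ _ h
    simp only [gt_iff_lt.1 h, iff_true]
    omega

/-! ### The 0-Hecke algebra and modules with a multiplicative basis -/

/-- The defining relations of the 0-Hecke algebra in the generators `π i`. -/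
inductive HeckeRel (n : ℕ) :
    FreeAlgebra ℂ (Fin (n - 1)) → FreeAlgebra ℂ (Fin (n - 1)) → Prop
  | idem (i : Fin (n - 1)) :
      HeckeRel n (FreeAlgebra.ι ℂ i * FreeAlgebra.ι ℂ i) (FreeAlgebra.ι ℂ i)
  | braid (i j : Fin (n - 1)) (h : i.1 + 1 = j.1) :
      HeckeRel n (FreeAlgebra.ι ℂ i * FreeAlgebra.ι ℂ j * FreeAlgebra.ι ℂ i)
        (FreeAlgebra.ι ℂ j * FreeAlgebra.ι ℂ i * FreeAlgebra.ι ℂ j)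
  | comm (i j : Fin (n - 1)) (h : i.1 + 1 < j.1) :
      HeckeRel n (FreeAlgebra.ι ℂ i * FreeAlgebra.ι ℂ j) (FreeAlgebra.ι ℂ j * FreeAlgebra.ι ℂ i)

/-- The 0-Hecke algebra `H_n(0)` over `ℂ`. -/
def HeckeZero (n : ℕ) : Type := RingQuot (HeckeRel n)

noncomputable instance : Ring (HeckeZero n) := inferInstanceAs (Ring (RingQuot (HeckeRel n)))

noncomputable instance : Algebra ℂ (HeckeZero n) :=
  inferInstanceAs (Algebra ℂ (RingQuot (HeckeRel n)))

/-- The presentation of the 0-Hecke algebra as a quotient of a free algebra. -/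
noncomputable def HeckeZero.mk (n : ℕ) : FreeAlgebra ℂ (Fin (n - 1)) →ₐ[ℂ] HeckeZero n :=
  RingQuot.mkAlgHom ℂ (HeckeRel n)

theorem HeckeZero.mk_surjective (n : ℕ) : Function.Surjective (HeckeZero.mk n) :=
  RingQuot.mkAlgHom_surjective ℂ (HeckeRel n)

/-- The generator `π i` of the 0-Hecke algebra. -/
noncomputable def HeckeZero.pi (i : Fin (n - 1)) : HeckeZero n :=
  HeckeZero.mk n (FreeAlgebra.ι ℂ i)

/-- An action of the generators of `H_n(0)` on `X ∪ {0}` satisfying the relations of `H_n(0)`;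
the value `none` stands for `0`. -/
structure ZeroHeckeSet (n : ℕ) (X : Type) where
  act : Fin (n - 1) → X → Option X
  idem : ∀ i x, (act i x).bind (act i) = act i x
  braid : ∀ i j : Fin (n - 1), i.1 + 1 = j.1 → ∀ x,
    ((act i x).bind (act j)).bind (act i) = ((act j x).bind (act i)).bind (act j)
  comm : ∀ i j : Fin (n - 1), i.1 + 1 < j.1 → ∀ x,
    (act i x).bind (act j) = (act j x).bind (act i)

namespace ZeroHeckeSet

variable {X : Type} (A : ZeroHeckeSet n X)

/-- The linear operator on the `ℂ`-span of `X` induced by a map `X → X ∪ {0}`. -/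
noncomputable def linOp (f : X → Option X) : Module.End ℂ (X →₀ ℂ) :=
  Finsupp.linearCombination ℂ fun x => (f x).elim 0 fun y => Finsupp.single y 1

theorem linOp_single (f : X → Option X) (x : X) :
    linOp f (Finsupp.single x 1) = (f x).elim 0 fun y => Finsupp.single y 1 := by
  simp [linOp]

theorem linOp_mul (f g : X → Option X) :
    linOp f * linOp g = linOp fun x => (g x).bind f := by
  apply Finsupp.lhom_ext'
  intro x
  apply LinearMap.ext_ring
  simp only [LinearMap.comp_apply, Finsupp.lsingle_apply, Module.End.mul_apply, linOp_single]
  cases g x with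
  | none => simp
  | some y => simp [linOp_single]

/-- The representation of `H_n(0)` on the `ℂ`-span of `X`. -/
noncomputable def rep : HeckeZero n →ₐ[ℂ] Module.End ℂ (X →₀ ℂ) :=
  RingQuot.liftAlgHom ℂ ⟨FreeAlgebra.lift ℂ fun i => linOp (A.act i), by
    intro a b h
    induction h with
    | idem i => simp [linOp_mul, A.idem]
    | braid i j h =>
      simp only [map_mul, FreeAlgebra.lift_ι_apply, linOp_mul]
      congr 1
      funext x
      have := A.braid i j h x
      rw [Option.bind_assoc, Option.bind_assoc] at this
      exact this
    | comm i j h =>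
      simp only [map_mul, FreeAlgebra.lift_ι_apply, linOp_mul]
      congr 1
      funext x
      exact (A.comm i j h x).symm⟩

theorem rep_pi (i : Fin (n - 1)) : A.rep (HeckeZero.pi i) = linOp (A.act i) := by
  refine (RingQuot.liftAlgHom_mkAlgHom_apply _ _ _ _).trans ?_
  simp

/-- The `ℂ`-span of `X`, viewed as a left `H_n(0)`-module. -/
def Mod (_A : ZeroHeckeSet n X) : Type := X →₀ ℂ

noncomputable instance : AddCommGroup A.Mod := inferInstanceAs (AddCommGroup (X →₀ ℂ))

noncomputable instance : Module ℂ A.Mod := inferInstanceAs (Module ℂ (X →₀ ℂ))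

noncomputable instance : Module (HeckeZero n) A.Mod :=
  Module.compHom (X →₀ ℂ) A.rep.toRingHom

instance : IsScalarTower ℂ (HeckeZero n) A.Mod where
  smul_assoc c h m := by
    change A.rep (c • h) m = c • A.rep h m
    rw [map_smul]
    rfl

/-- The basis element of the module indexed by `x`. -/
noncomputable def basis (x : X) : A.Mod := Finsupp.single x (1 : ℂ)

/-- The generators act on the basis as prescribed. -/
theorem pi_smul_basis (i : Fin (n - 1)) (x : X) :
    HeckeZero.pi i • A.basis x = (A.act i x).elim 0 A.basis := by
  change A.rep (HeckeZero.pi i) (Finsupp.single x 1) = _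
  rw [rep_pi, linOp_single]
  rfl

/-- The submodule whose underlying space is the `ℂ`-span of a subset `U` that is closed under
the action of the generators. -/
noncomputable def spanSubmodule (U : Set X)
    (hU : ∀ i, ∀ x ∈ U, ∀ y, A.act i x = some y → y ∈ U) : Submodule (HeckeZero n) A.Mod where
  carrier := Submodule.span ℂ (A.basis '' U)
  add_mem' := Submodule.add_mem _
  zero_mem' := Submodule.zero_mem _
  smul_mem' := by
    have gen : ∀ i : Fin (n - 1), ∀ v ∈ Submodule.span ℂ (A.basis '' U),
        HeckeZero.pi i • v ∈ Submodule.span ℂ (A.basis '' U) := by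
      intro i v hv
      refine Submodule.span_induction (p := fun v _ =>
        HeckeZero.pi i • v ∈ Submodule.span ℂ (A.basis '' U)) ?_ ?_ ?_ ?_ hv
      · rintro _ ⟨x, hx, rfl⟩
        rw [pi_smul_basis]
        cases h : A.act i x with
        | none => exact Submodule.zero_mem _
        | some y => exact Submodule.subset_span ⟨y, hU i x hx y h, rfl⟩
      · rw [smul_zero]
        exact Submodule.zero_mem _
      · intro x y _ _ hx hy
        rw [smul_add]
        exact Submodule.add_mem _ hx hy
      · intro c x _ hx
        rw [smul_algebra_smul_comm]
        exact Submodule.smul_mem _ _ hx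
    intro h v hv
    obtain ⟨f, rfl⟩ := HeckeZero.mk_surjective n h
    induction f using FreeAlgebra.induction generalizing v with
    | grade0 c =>
      rw [AlgHom.commutes, algebraMap_smul]
      exact Submodule.smul_mem _ _ hv
    | grade1 i => exact gen i v hv
    | mul a b ha hb =>
      rw [map_mul, mul_smul]
      exact ha (hb hv)
    | add a b ha hb =>
      rw [map_add, add_smul]
      exact Submodule.add_mem _ (ha hv) (hb hv)

end ZeroHeckeSet

/-! ### Left weak Bruhat interval modules -/

/-- The action on permutations used below before restricting to an interval. -/
noncomputable def totalAct (i : Fin (n - 1)) (γ : Equiv.Perm (Fin n)) : Equiv.Perm (Fin n) :=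
  if i ∈ desL γ then γ else s i * γ

theorem le_totalAct (i : Fin (n - 1)) (γ : Equiv.Perm (Fin n)) :
    LeftWeakLE γ (totalAct i γ) := by
  unfold totalAct
  split_ifs with h
  · exact Relation.ReflTransGen.refl
  · exact Relation.ReflTransGen.single ⟨i, h, rfl⟩

theorem s_mul_inv_apply (i : Fin (n - 1)) (γ : Equiv.Perm (Fin n)) (v : Fin n) :
    (s i * γ)⁻¹ v = γ⁻¹ (s i v) := by
  simp [mul_inv_rev, s_inv]

theorem totalAct_idem (i : Fin (n - 1)) (γ : Equiv.Perm (Fin n)) :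
    totalAct i (totalAct i γ) = totalAct i γ := by
  by_cases h : i ∈ desL γ
  · simp [totalAct, h]
  · have h2 : i ∈ desL (s i * γ) := by
      rw [mem_desL_iff] at h ⊢
      rw [s_mul_inv_apply, s_mul_inv_apply, s_hi, s_lo]
      exact lt_of_le_of_ne (not_lt.1 h) (inv_lo_ne γ i)
    simp [totalAct, h, h2]

theorem s_fix (i : Fin (n - 1)) (v : Fin n) (h1 : v.1 ≠ i.1) (h2 : v.1 ≠ i.1 + 1) :
    s i v = v := by
  apply Fin.ext
  simp [s_apply_val, h1, h2]

theorem s_comm (i j : Fin (n - 1)) (h : i.1 + 1 < j.1) : s i * s j = s j * s i := by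
  ext v
  simp only [Equiv.Perm.mul_apply, s_apply_val]
  split_ifs <;> omega

theorem s_braid (i j : Fin (n - 1)) (h : i.1 + 1 = j.1) :
    s i * s j * s i = s j * s i * s j := by
  have hl : lo j = hi i := Fin.ext (by simp [lo, hi, h])
  have f1 : s i (hi j) = hi j := s_fix _ _ (by simp [hi]; omega) (by simp [hi]; omega)
  have f2 : s j (lo i) = lo i := s_fix _ _ (by simp [lo]; omega) (by simp [lo]; omega)
  have f3 : s j (hi i) = hi j := by rw [← hl, s_lo]
  have f4 : s j (hi j) = hi i := by rw [← hl, s_hi]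
  apply Equiv.ext
  intro v
  simp only [Equiv.Perm.mul_apply]
  by_cases h1 : v = lo i
  · rw [h1, s_lo, f3, f1, f2, s_lo, f3]
  by_cases h2 : v = hi i
  · rw [h2, s_hi, f2, s_lo, f3, f1, f4]
  by_cases h3 : v = hi j
  · rw [h3, f1, f4, s_hi, f2]
  have g1 : s i v = v := s_fix _ _ (fun e => h1 (Fin.ext e)) (fun e => h2 (Fin.ext e))
  have g2 : s j v = v :=
    s_fix _ _ (fun e => h2 (Fin.ext (e.trans h.symm))) (fun e => h3 (Fin.ext e))
  rw [g1, g2, g1, g2]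

theorem totalAct_comm (i j : Fin (n - 1)) (h : i.1 + 1 < j.1) (γ : Equiv.Perm (Fin n)) :
    totalAct i (totalAct j γ) = totalAct j (totalAct i γ) := by
  have e1 : ∀ γ : Equiv.Perm (Fin n), i ∈ desL (s j * γ) ↔ i ∈ desL γ := by
    intro γ
    rw [mem_desL_iff, mem_desL_iff, s_mul_inv_apply, s_mul_inv_apply,
      s_fix j (hi i) (by simp [hi]; omega) (by simp [hi]; omega),
      s_fix j (lo i) (by simp [lo]; omega) (by simp [lo]; omega)]
  have e2 : ∀ γ : Equiv.Perm (Fin n), j ∈ desL (s i * γ) ↔ j ∈ desL γ := by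
    intro γ
    rw [mem_desL_iff, mem_desL_iff, s_mul_inv_apply, s_mul_inv_apply,
      s_fix i (hi j) (by simp [hi]; omega) (by simp [hi]; omega),
      s_fix i (lo j) (by simp [lo]; omega) (by simp [lo]; omega)]
  by_cases h1 : i ∈ desL γ <;> by_cases h2 : j ∈ desL γ <;>
    simp [totalAct, h1, h2, e1, e2, ← mul_assoc, s_comm i j h]

theorem totalAct_braid (i j : Fin (n - 1)) (h : i.1 + 1 = j.1) (γ : Equiv.Perm (Fin n)) :
    totalAct i (totalAct j (totalAct i γ)) = totalAct j (totalAct i (totalAct j γ)) := by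
  have hl : lo j = hi i := Fin.ext (by simp [lo, hi, h])
  have f1 : s i (hi j) = hi j := s_fix _ _ (by simp [hi]; omega) (by simp [hi]; omega)
  have f2 : s j (lo i) = lo i := s_fix _ _ (by simp [lo]; omega) (by simp [lo]; omega)
  have f3 : s j (hi i) = hi j := by rw [← hl, s_lo]
  have f4 : s j (hi j) = hi i := by rw [← hl, s_hi]
  have n1 : γ⁻¹ (lo i) ≠ γ⁻¹ (hi i) := inv_lo_ne γ i
  have n2 : γ⁻¹ (hi i) ≠ γ⁻¹ (hi j) := hl ▸ inv_lo_ne γ j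
  have n3 : γ⁻¹ (lo i) ≠ γ⁻¹ (hi j) := by
    intro e
    have := congrArg Fin.val (γ⁻¹.injective e)
    simp [lo, hi] at this
    omega
  have br : s i * (s j * (s i * γ)) = s j * (s i * (s j * γ)) := by
    simp only [← mul_assoc, s_braid i j h]
  rcases lt_or_gt_of_ne n1 with h1 | h1 <;> rcases lt_or_gt_of_ne n2 with h2 | h2 <;>
    rcases lt_or_gt_of_ne n3 with h3 | h3 <;>
    first
    | (exfalso; simp only [Fin.lt_def] at h1 h2 h3; omega)
    | (have h1' := h1.not_gt
       have h2' := h2.not_gt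
       have h3' := h3.not_gt
       simp only [totalAct, mem_desL_iff, hl, s_mul_inv_apply, f1, f2, f3, f4, s_lo, s_hi, h1,
         h2, h3, h1', h2', h3', if_true, if_false, br])

/-- Restriction of an element to a subset of the basis, elements outside being sent to `0`. -/
noncomputable def restrictTo (σ ρ γ : Equiv.Perm (Fin n)) : Option ↥(leftInterval σ ρ) :=
  if h : γ ∈ leftInterval σ ρ then some ⟨γ, h⟩ else none

theorem restrictTo_bind (σ ρ γ : Equiv.Perm (Fin n)) (hγ : LeftWeakLE σ γ) (i : Fin (n - 1)) :
    ((restrictTo σ ρ γ).bind fun x => restrictTo σ ρ (totalAct i x.1)) =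
      restrictTo σ ρ (totalAct i γ) := by
  by_cases h : γ ∈ leftInterval σ ρ
  · simp [restrictTo, h]
  · have h2 : totalAct i γ ∉ leftInterval σ ρ := fun h2 =>
      h ⟨hγ, (le_totalAct i γ).trans h2.2⟩
    simp [restrictTo, h, h2]

/-- The action on the basis `[σ, ρ]_L` of the left weak Bruhat interval module. -/
noncomputable def intervalAct (σ ρ : Equiv.Perm (Fin n)) (i : Fin (n - 1))
    (γ : ↥(leftInterval σ ρ)) : Option ↥(leftInterval σ ρ) :=
  if i ∈ desL γ.1 then some γ
  else if h : s i * γ.1 ∈ leftInterval σ ρ then some ⟨s i * γ.1, h⟩ else none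

theorem intervalAct_eq (σ ρ : Equiv.Perm (Fin n)) (i : Fin (n - 1)) :
    intervalAct σ ρ i = fun γ => restrictTo σ ρ (totalAct i γ.1) := by
  funext γ
  by_cases h : i ∈ desL γ.1
  · simp [intervalAct, restrictTo, totalAct, h]
  · simp [intervalAct, restrictTo, totalAct, h]

/-- The left weak Bruhat interval `[σ, ρ]_L` as a multiplicative basis. -/
noncomputable def intervalSet (σ ρ : Equiv.Perm (Fin n)) :
    ZeroHeckeSet n ↥(leftInterval σ ρ) where
  act := intervalAct σ ρ
  idem i γ := by
    have a := γ.2.1.trans (le_totalAct i γ.1)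
    rw [intervalAct_eq, restrictTo_bind _ _ _ a, totalAct_idem]
  braid i j h γ := by
    have a := γ.2.1.trans (le_totalAct i γ.1)
    have b := γ.2.1.trans (le_totalAct j γ.1)
    rw [intervalAct_eq, intervalAct_eq, restrictTo_bind _ _ _ a, restrictTo_bind _ _ _ b,
      restrictTo_bind _ _ _ (a.trans (le_totalAct _ _)),
      restrictTo_bind _ _ _ (b.trans (le_totalAct _ _)), totalAct_braid i j h]
  comm i j h γ := by
    have a := γ.2.1.trans (le_totalAct i γ.1)
    have b := γ.2.1.trans (le_totalAct j γ.1)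
    rw [intervalAct_eq, intervalAct_eq, restrictTo_bind _ _ _ a, restrictTo_bind _ _ _ b,
      totalAct_comm i j h]

/-- The left weak Bruhat interval module `B_L(σ, ρ)`. -/
abbrev BL (σ ρ : Equiv.Perm (Fin n)) : Type := (intervalSet σ ρ).Mod

/-! ### Enumeration of a finite set along a sorting key -/

/-- The enumeration of a set with `n` elements in increasing order of an injective key. -/
noncomputable def sortEquiv {X K : Type} [Fintype X] [LinearOrder K] (key : X → K)
    (hkey : Function.Injective key) (h : Fintype.card X = n) : Fin n ≃ X :=
  letI : LinearOrder X := LinearOrder.lift' key hkey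
  (monoEquivOfFin X h).toEquiv

theorem key_sortEquiv_lt {X K : Type} [Fintype X] [LinearOrder K] (key : X → K)
    (hkey : Function.Injective key) (h : Fintype.card X = n) (k l : Fin n) :
    key (sortEquiv key hkey h k) < key (sortEquiv key hkey h l) ↔ k < l := by
  let : LinearOrder X := LinearOrder.lift' key hkey
  exact (monoEquivOfFin X h).lt_iff_lt

/-! ### Standard reverse composition tableaux -/

/-- The composition diagram of `α`: the box `⟨r, c⟩` lies in row `r + 1` (from the top) and column
`c + 1` (from the left). -/
abbrev Cell (α : Composition n) : Type := (r : Fin α.length) × Fin (α.blocksFun r)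

namespace Cell

variable {α : Composition n}

/-- The row of a box, counted from `0`. -/
def row (p : Cell α) : ℕ := p.1.1

/-- The column of a box, counted from `0`. -/
def col (p : Cell α) : ℕ := p.2.1

theorem ext_row_col {p q : Cell α} (h1 : p.row = q.row) (h2 : p.col = q.col) : p = q := by
  obtain ⟨r, c⟩ := p
  obtain ⟨r', c'⟩ := q
  obtain rfl : r = r' := Fin.ext h1
  obtain rfl : c = c' := Fin.ext h2
  rfl

theorem card_eq (α : Composition n) : Fintype.card (Cell α) = n := by
  simp [Cell, α.sum_blocksFun]

end Cell

/-- Condition for an entry at box `p` to attack a larger entry at box `q`. -/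
def Attacks {α : Composition n} (p q : Cell α) : Prop :=
  p.col = q.col ∨ (q.col = p.col + 1 ∧ p.row < q.row)

/-- Standard reverse composition tableaux of shape `α`. The filling uses every entry exactly
once. -/
@[ext]
structure SRCT (α : Composition n) where
  entry : Cell α ≃ Fin n
  row_decreasing : ∀ p q : Cell α, p.row = q.row → p.col < q.col → entry q < entry p
  col_increasing : ∀ p q : Cell α, p.col = 0 → q.col = 0 → p.row < q.row → entry p < entry q
  triple : ∀ p q : Cell α, p.row < q.row → q.col = p.col + 1 → entry q < entry p →
    ∃ t : Cell α, t.row = p.row ∧ t.col = q.col ∧ entry q < entry t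

namespace SRCT

variable {α : Composition n}

/-- The box containing the entry `v`. -/
def pos (τ : SRCT α) (v : Fin n) : Cell α := τ.entry.symm v

/-- The descents: those `i` for which `i + 1` appears weakly right of `i`. -/
noncomputable def Des (τ : SRCT α) : Finset (Fin (n - 1)) :=
  Finset.univ.filter fun i => (τ.pos (lo i)).col ≤ (τ.pos (hi i)).col

/-- Source tableaux: for each non-descent `i`, the entry `i + 1` is immediately left of `i`. -/
def IsSource (τ : SRCT α) : Prop :=
  ∀ i, i ∉ τ.Des →
    (τ.pos (hi i)).row = (τ.pos (lo i)).row ∧ (τ.pos (hi i)).col + 1 = (τ.pos (lo i)).col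

/-- Sink tableaux: every descent `i` is attacking. -/
def IsSink (τ : SRCT α) : Prop :=
  ∀ i, i ∈ τ.Des → Attacks (τ.pos (lo i)) (τ.pos (hi i))

/-- The letter at box `p` of the standardized column word of the column containing `p`. -/
noncomputable def std (τ : SRCT α) (p : Cell α) : ℕ :=
  (Finset.univ.filter fun q : Cell α => q.col = p.col ∧ τ.entry q ≤ τ.entry p).card

/-- Two tableaux are equivalent when all their standardized column words agree. -/
def equivalence (α : Composition n) : Setoid (SRCT α) where
  r τ₁ τ₂ := ∀ p, τ₁.std p = τ₂.std p
  iseqv := ⟨fun _ _ => rfl, fun h p => (h p).symm, fun h h' p => (h p).trans (h' p)⟩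

/-- The set of equivalence classes. -/
abbrev EqClass (α : Composition n) : Type := Quotient (equivalence α)

/-- The equivalence class of a tableau. -/
def toClass (τ : SRCT α) : EqClass α := Quotient.mk (equivalence α) τ

theorem pos_eq {τ : SRCT α} {p : Cell α} {v : Fin n} (h : τ.entry p = v) : τ.pos v = p := by
  rw [← h]; exact τ.entry.symm_apply_apply p

theorem s_lt_s (i : Fin (n - 1)) {a b : Fin n} (h : a < b) (hne : ¬ (a = lo i ∧ b = hi i)) :
    s i a < s i b := by
  have hne' : ¬ (a.1 = i.1 ∧ b.1 = i.1 + 1) := fun e => hne ⟨Fin.ext e.1, Fin.ext e.2⟩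
  simp only [Fin.lt_def, s_apply_val] at h ⊢
  split_ifs <;> omega

/-- The tableau obtained by exchanging `i` and `i + 1`, for a nonattacking descent `i`. -/
def swap (τ : SRCT α) (i : Fin (n - 1)) (hd : i ∈ τ.Des)
    (ha : ¬ Attacks (τ.pos (lo i)) (τ.pos (hi i))) : SRCT α where
  entry := τ.entry.trans (s i)
  row_decreasing p q hr hc := by
    refine s_lt_s i (τ.row_decreasing p q hr hc) ?_
    rintro ⟨h1, h2⟩
    have hd' : (τ.pos (lo i)).col ≤ (τ.pos (hi i)).col := by simpa [Des] using hd
    rw [pos_eq h1, pos_eq h2] at hd'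
    omega
  col_increasing p q hp hq hr := by
    refine s_lt_s i (τ.col_increasing p q hp hq hr) ?_
    rintro ⟨h1, h2⟩
    rw [pos_eq h1, pos_eq h2] at ha
    exact ha (Or.inl (hp.trans hq.symm))
  triple p q hr hc h := by
    have h0 : τ.entry q < τ.entry p := by
      have := s_lt_s i h (by
        rintro ⟨h1, h2⟩
        have h1' : τ.entry q = hi i := by
          rw [← s_s i (τ.entry q)]; exact (congrArg (s i) h1).trans (s_lo i)
        have h2' : τ.entry p = lo i := by
          rw [← s_s i (τ.entry p)]; exact (congrArg (s i) h2).trans (s_hi i)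
        rw [pos_eq h1', pos_eq h2'] at ha
        exact ha (Or.inr ⟨hc, hr⟩))
      simpa [s_s] using this
    obtain ⟨t, ht1, ht2, ht3⟩ := τ.triple p q hr hc h0
    refine ⟨t, ht1, ht2, s_lt_s i ht3 ?_⟩
    rintro ⟨h1, h2⟩
    rw [pos_eq h1, pos_eq h2] at ha
    exact ha (Or.inl ht2.symm)

/-- The action on tableaux: `π i` fixes `τ` if `i` is not a descent, kills `τ` if `i` is an
attacking descent, and exchanges `i` and `i + 1` if `i` is a nonattacking descent. -/
noncomputable def act (i : Fin (n - 1)) (τ : SRCT α) : Option (SRCT α) :=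
  if hd : i ∈ τ.Des then
    if ha : Attacks (τ.pos (lo i)) (τ.pos (hi i)) then none else some (τ.swap i hd ha)
  else some τ

/-- The exchange of `i` and `i + 1` in a bijective filling. -/
def swapFill (i : Fin (n - 1)) (e : Cell α ≃ Fin n) : Cell α ≃ Fin n := e.trans (s i)

/-- The same rule on arbitrary bijective fillings. -/
noncomputable def fillAct (i : Fin (n - 1)) (e : Cell α ≃ Fin n) : Option (Cell α ≃ Fin n) :=
  if (e.symm (lo i)).col ≤ (e.symm (hi i)).col then
    if Attacks (e.symm (lo i)) (e.symm (hi i)) then none else some (swapFill i e)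
  else some e

theorem map_act (i : Fin (n - 1)) (τ : SRCT α) :
    (act i τ).map entry = fillAct i τ.entry := by
  have hd : i ∈ τ.Des ↔ (τ.entry.symm (lo i)).col ≤ (τ.entry.symm (hi i)).col := by
    unfold Des pos
    rw [Finset.mem_filter]
    exact and_iff_right (Finset.mem_univ _)
  unfold act fillAct
  by_cases h1 : i ∈ τ.Des
  · rw [dif_pos h1, if_pos (hd.1 h1)]
    by_cases h2 : Attacks (τ.pos (lo i)) (τ.pos (hi i))
    · rw [dif_pos h2, if_pos (by exact h2)]; rfl
    · rw [dif_neg h2, if_neg (by exact h2)]; rfl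
  · rw [dif_neg h1, if_neg (fun h => h1 (hd.2 h))]; rfl

theorem map_bind_act (i : Fin (n - 1)) (o : Option (SRCT α)) :
    (o.bind (act i)).map entry = (o.map entry).bind (fillAct i) := by
  cases o with
  | none => rfl
  | some τ => exact map_act i τ

theorem entry_injective : Function.Injective (entry : SRCT α → (Cell α ≃ Fin n)) :=
  fun _ _ h => SRCT.ext h

/-- Position of an entry after an exchange. -/
theorem swapFill_symm (e : Cell α ≃ Fin n) (i : Fin (n - 1)) (v : Fin n) :
    (swapFill i e).symm v = e.symm (s i v) := by
  rw [swapFill, Equiv.symm_trans_apply]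
  congr 1

theorem trichotomy (p q : Cell α) :
    (q.col < p.col ∧ ¬ p.col ≤ q.col) ∨ (p.col ≤ q.col ∧ q.col ≤ p.col + 1 ∧ Attacks p q) ∨
      (p.col < q.col ∧ p.col ≤ q.col ∧ ¬ Attacks p q ∧ ¬ q.col ≤ p.col) := by
  unfold Attacks
  by_cases h : p.row < q.row <;> simp only [h, and_true, and_false, or_false] <;> omega

theorem fillAct_idem (i : Fin (n - 1)) (e : Cell α ≃ Fin n) :
    (fillAct i e).bind (fillAct i) = fillAct i e := by
  rcases trichotomy (e.symm (lo i)) (e.symm (hi i)) with ⟨h1, h2⟩ | ⟨h1, h2, h3⟩ | ⟨h1, h2, h3, h4⟩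
  · simp [fillAct, h2]
  · simp [fillAct, h1, h3]
  · simp [fillAct, h2, h3, swapFill_symm, s_lo, s_hi, h4]

theorem fillAct_comm (i j : Fin (n - 1)) (h : i.1 + 1 < j.1) (e : Cell α ≃ Fin n) :
    (fillAct i e).bind (fillAct j) = (fillAct j e).bind (fillAct i) := by
  have g1 : s j (lo i) = lo i := s_fix _ _ (by simp [lo]; omega) (by simp [lo]; omega)
  have g2 : s j (hi i) = hi i := s_fix _ _ (by simp [hi]; omega) (by simp [hi]; omega)
  have g3 : s i (lo j) = lo j := s_fix _ _ (by simp [lo]; omega) (by simp [lo]; omega)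
  have g4 : s i (hi j) = hi j := s_fix _ _ (by simp [hi]; omega) (by simp [hi]; omega)
  have sc : swapFill j (swapFill i e) = swapFill i (swapFill j e) := by
    ext p
    exact congrArg Fin.val (DFunLike.congr_fun (s_comm i j h).symm (e p))
  rcases trichotomy (e.symm (lo i)) (e.symm (hi i)) with
      ⟨h1, h2⟩ | ⟨h1, h2, h3⟩ | ⟨h1, h2, h3, h4⟩ <;>
    rcases trichotomy (e.symm (lo j)) (e.symm (hi j)) with
      ⟨k1, k2⟩ | ⟨k1, k2, k3⟩ | ⟨k1, k2, k3, k4⟩ <;>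
    simp [fillAct, swapFill_symm, *]

theorem fillAct_braid (i j : Fin (n - 1)) (h : i.1 + 1 = j.1) (e : Cell α ≃ Fin n) :
    ((fillAct i e).bind (fillAct j)).bind (fillAct i) =
      ((fillAct j e).bind (fillAct i)).bind (fillAct j) := by
  have hl : lo j = hi i := Fin.ext (by simp [lo, hi, h])
  have f1 : s i (hi j) = hi j := s_fix _ _ (by simp [hi]; omega) (by simp [hi]; omega)
  have f2 : s j (lo i) = lo i := s_fix _ _ (by simp [lo]; omega) (by simp [lo]; omega)
  have f3 : s j (hi i) = hi j := by rw [← hl, s_lo]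
  have f4 : s j (hi j) = hi i := by rw [← hl, s_hi]
  have br : swapFill i (swapFill j (swapFill i e)) =
      swapFill j (swapFill i (swapFill j e)) := by
    ext p
    exact congrArg Fin.val (DFunLike.congr_fun (s_braid i j h) (e p))
  rcases trichotomy (e.symm (lo i)) (e.symm (hi i)) with
      ⟨h1, h2⟩ | ⟨h1, h2, h3⟩ | ⟨h1, h2, h3, h4⟩ <;>
    rcases trichotomy (e.symm (hi i)) (e.symm (hi j)) with
      ⟨k1, k2⟩ | ⟨k1, k2, k3⟩ | ⟨k1, k2, k3, k4⟩ <;>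
    rcases trichotomy (e.symm (lo i)) (e.symm (hi j)) with
      ⟨l1, l2⟩ | ⟨l1, l2, l3⟩ | ⟨l1, l2, l3, l4⟩ <;>
    first
    | (exfalso; omega)
    | simp [fillAct, swapFill_symm, s_lo, s_hi, *]

/-- The standard reverse composition tableaux of shape `α` as a multiplicative basis. -/
noncomputable def heckeSet (α : Composition n) : ZeroHeckeSet n (SRCT α) where
  act := act
  idem i τ := by
    apply Option.map_injective entry_injective
    rw [map_bind_act, map_act, fillAct_idem]
  braid i j h τ := by
    apply Option.map_injective entry_injective
    simp only [map_bind_act, map_act, fillAct_braid i j h]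
  comm i j h τ := by
    apply Option.map_injective entry_injective
    simp only [map_bind_act, map_act, fillAct_comm i j h]

theorem toClass_swap (τ : SRCT α) (i : Fin (n - 1)) (hd : i ∈ τ.Des)
    (ha : ¬ Attacks (τ.pos (lo i)) (τ.pos (hi i))) : (τ.swap i hd ha).toClass = τ.toClass := by
  apply Quotient.sound
  intro p
  unfold std
  congr 1
  ext q
  simp only [Finset.mem_filter, Finset.mem_univ, true_and, and_congr_right_iff]
  intro hc
  change s i (τ.entry q) ≤ s i (τ.entry p) ↔ τ.entry q ≤ τ.entry p
  rw [← not_lt, ← not_lt, not_iff_not]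
  constructor
  · intro h
    have := s_lt_s i h (by
      rintro ⟨h1, h2⟩
      have h1' : τ.entry p = hi i := by rw [← s_s i (τ.entry p), h1, s_lo]
      have h2' : τ.entry q = lo i := by rw [← s_s i (τ.entry q), h2, s_hi]
      rw [pos_eq h1', pos_eq h2'] at ha
      exact ha (Or.inl hc))
    simpa [s_s] using this
  · intro h
    refine s_lt_s i h ?_
    rintro ⟨h1, h2⟩
    rw [pos_eq h1, pos_eq h2] at ha
    exact ha (Or.inl hc.symm)

theorem toClass_act (i : Fin (n - 1)) (τ τ' : SRCT α) (h : act i τ = some τ') :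
    τ'.toClass = τ.toClass := by
  unfold act at h
  split_ifs at h with h1 h2
  · rw [← Option.some.inj h, toClass_swap]
  · rw [Option.some.inj h]

/-- The `H_n(0)`-module spanned by all standard reverse composition tableaux of shape `α`. -/
abbrev moduleS (α : Composition n) : Type := (heckeSet α).Mod

/-- The submodule of `moduleS α` whose underlying space is the `ℂ`-span of the class `E`. -/
noncomputable def moduleSE (α : Composition n) (E : EqClass α) :
    Submodule (HeckeZero n) (moduleS α) :=
  (heckeSet α).spanSubmodule {τ | τ.toClass = E} fun i τ hτ τ' h =>
    (toClass_act i τ τ' h).trans hτ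

/-! ### Reading words -/

/-- The index `j - 1` of the horizontal strip `H_j` containing the box `p`: the number of
descents of `τ₀` that are smaller than the entry of `τ₀` at `p`. -/
noncomputable def strip (τ₀ : SRCT α) (p : Cell α) : ℕ :=
  (τ₀.Des.filter fun i => lo i < τ₀.entry p).card

/-- The strip and the column of a box determine its place in the reading order. -/
noncomputable def readKey (τ₀ : SRCT α) (p : Cell α) : ℕ ×ₗ ℕ := toLex (τ₀.strip p, p.col)

theorem col_lt_of_forall_notMem (τ₀ : SRCT α) (q : Cell α) (k : ℕ) : ∀ p : Cell α,
    (τ₀.entry q).1 = (τ₀.entry p).1 + (k + 1) →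
    (∀ i, τ₀.entry p ≤ lo i → lo i < τ₀.entry q → i ∉ τ₀.Des) → q.col < p.col := by
  induction k with
  | zero =>
    intro p hpq h
    have hq := (τ₀.entry q).2
    have h1 := h ⟨(τ₀.entry p).1, by omega⟩ le_rfl (by simp only [Fin.lt_def, lo]; omega)
    simp only [Des, Finset.mem_filter, Finset.mem_univ, true_and, not_le] at h1
    have e1 : τ₀.pos (lo ⟨(τ₀.entry p).1, by omega⟩) = p := pos_eq rfl
    rwa [pos_eq (p := q) (Fin.ext hpq), e1] at h1
  | succ k ih =>
    intro p hpq h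
    have hq := (τ₀.entry q).2
    have h1 := h ⟨(τ₀.entry p).1, by omega⟩ le_rfl (by simp only [Fin.lt_def, lo]; omega)
    simp only [Des, Finset.mem_filter, Finset.mem_univ, true_and, not_le] at h1
    have e1 : τ₀.pos (lo ⟨(τ₀.entry p).1, by omega⟩) = p := pos_eq rfl
    rw [e1] at h1
    refine lt_trans (ih _ ?_ ?_) h1
    · simp only [pos, Equiv.apply_symm_apply, hi]
      omega
    · intro i hi1 hi2
      refine h i (le_trans ?_ hi1) hi2
      simp only [pos, Equiv.apply_symm_apply, hi, Fin.le_def]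
      omega

theorem col_lt_of_strip_eq (τ₀ : SRCT α) (k : ℕ) (p q : Cell α)
    (hpq : (τ₀.entry q).1 = (τ₀.entry p).1 + (k + 1)) (h : τ₀.strip p = τ₀.strip q) :
    q.col < p.col := by
  refine τ₀.col_lt_of_forall_notMem q k p hpq fun i h1 h2 h3 => h.not_lt ?_
  apply Finset.card_lt_card
  rw [Finset.ssubset_iff_of_subset]
  · exact ⟨i, Finset.mem_filter.2 ⟨h3, h2⟩, fun h4 => (Finset.mem_filter.1 h4).2.not_ge h1⟩
  · intro j hj
    rw [Finset.mem_filter] at hj ⊢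
    refine ⟨hj.1, hj.2.trans ?_⟩
    rw [Fin.lt_def]
    omega

theorem readKey_injective (τ₀ : SRCT α) : Function.Injective τ₀.readKey := by
  intro p q h
  have h1 : τ₀.strip p = τ₀.strip q := congrArg (fun x => (ofLex x).1) h
  have h2 : p.col = q.col := congrArg (fun x => (ofLex x).2) h
  by_contra hne
  have hne' : (τ₀.entry p).1 ≠ (τ₀.entry q).1 := fun e => hne (τ₀.entry.injective (Fin.ext e))
  rcases lt_or_gt_of_ne hne' with h3 | h3
  · have := τ₀.col_lt_of_strip_eq ((τ₀.entry q).1 - (τ₀.entry p).1 - 1) p q (by omega) h1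
    omega
  · have := τ₀.col_lt_of_strip_eq ((τ₀.entry p).1 - (τ₀.entry q).1 - 1) q p (by omega) h1.symm
    omega

/-- The enumeration of the boxes strip after strip, each strip being read from left to right. -/
noncomputable def readOrder (τ₀ : SRCT α) : Fin n ≃ Cell α :=
  sortEquiv τ₀.readKey τ₀.readKey_injective (Cell.card_eq α)

/-- `readOrder` lists the boxes in increasing order of strip, then of column. -/
theorem readKey_readOrder_lt (τ₀ : SRCT α) (k l : Fin n) :
    τ₀.readKey (τ₀.readOrder k) < τ₀.readKey (τ₀.readOrder l) ↔ k < l :=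
  key_sortEquiv_lt _ _ _ k l

/-- The reading word of `τ`, as a permutation in one-line notation, with respect to the
decomposition of the diagram into horizontal strips given by the source tableau `τ₀`. -/
noncomputable def read (τ₀ τ : SRCT α) : Equiv.Perm (Fin n) := τ₀.readOrder.trans τ.entry

end SRCT

/-! ### Posets on `[n]` -/

/-- The set of permutations `γ` such that `γ(1) γ(2) ⋯ γ(n)` is a linear extension of `P`. -/
def linExtR (P : PartialOrder (Fin n)) : Set (Equiv.Perm (Fin n)) :=
  {γ | ∀ i j, P.lt i j → γ⁻¹ i < γ⁻¹ j}

/-- The `n`-element subsets of `ℕ × ℕ` (with coordinates counted from `1`) without empty rows or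
columns. A pair `(x, y)` is the box in column `x` (from the left) and row `y` (from below). -/
def IsDiagram (n : ℕ) (D : Finset (ℕ × ℕ)) : Prop :=
  D.card = n ∧ (∃ k, D.image Prod.snd = Finset.Icc 1 k) ∧
    ∃ l, D.image Prod.fst = Finset.Icc 1 l

/-- Sorting key of a box: rows from the top downwards, then columns from left to right. -/
def boxKey (D : Finset (ℕ × ℕ)) (d : ↥D) : ℕᵒᵈ ×ₗ ℕ := toLex (OrderDual.toDual d.1.2, d.1.1)

theorem boxKey_injective (D : Finset (ℕ × ℕ)) : Function.Injective (boxKey D) := by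
  intro d d' h
  have h1 : d.1.2 = d'.1.2 :=
    congrArg (fun x : ℕᵒᵈ ×ₗ ℕ => OrderDual.ofDual (ofLex x).1) h
  have h2 : d.1.1 = d'.1.1 := congrArg (fun x : ℕᵒᵈ ×ₗ ℕ => (ofLex x).2) h
  exact Subtype.ext (Prod.ext h2 h1)

/-- The enumeration of the boxes of `D` along the rows from left to right, starting with the
uppermost row. -/
noncomputable def boxOrder (D : Finset (ℕ × ℕ)) (h : D.card = n) : Fin n ≃ ↥D :=
  sortEquiv (boxKey D) (boxKey_injective D) ((Fintype.card_coe D).trans h)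

/-- `boxOrder` lists the boxes in increasing order of `boxKey`. -/
theorem boxKey_boxOrder_lt (D : Finset (ℕ × ℕ)) (h : D.card = n) (k l : Fin n) :
    boxKey D (boxOrder D h k) < boxKey D (boxOrder D h l) ↔ k < l :=
  key_sortEquiv_lt _ _ _ k l

/-- The canonical poset of a diagram: `i ≼ j` iff `x_i ≤ x_j` and `y_i ≤ y_j`. -/
noncomputable abbrev canonicalPoset (D : Finset (ℕ × ℕ)) (hD : IsDiagram n D) :
    PartialOrder (Fin n) :=
  PartialOrder.lift (fun i => (boxOrder D hD.1 i : ℕ × ℕ))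
    (Subtype.val_injective.comp (boxOrder D hD.1).injective)

theorem canonicalPoset_le_iff (D : Finset (ℕ × ℕ)) (hD : IsDiagram n D) (i j : Fin n) :
    (canonicalPoset D hD).le i j ↔
      (boxOrder D hD.1 i).1.1 ≤ (boxOrder D hD.1 j).1.1 ∧
        (boxOrder D hD.1 i).1.2 ≤ (boxOrder D hD.1 j).1.2 :=
  Iff.rfl

/-! ### Compositions and the diagram `D_{α;ρ}` -/

/-- The set of partial sums of a composition of `n`, as a subset of `[n-1]`. -/
noncomputable def setOf (α : Composition n) : Finset (Fin (n - 1)) :=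
  compositionAsSetEquiv n (compositionEquiv n α)

/-- The composition of `n` with a given set of partial sums. -/
noncomputable def comp (I : Finset (Fin (n - 1))) : Composition n :=
  (compositionEquiv n).symm ((compositionAsSetEquiv n).symm I)

/-- The complement of a composition. -/
noncomputable def compl (α : Composition n) : Composition n := comp (setOf α)ᶜ

/-- The set of letters of `[n]` belonging to the block with (zero-based) index `j` of `β`. -/
noncomputable def block (β : Composition n) (j : ℕ) : Finset (Fin n) :=
  Finset.univ.filter fun r => β.sizeUpTo j ≤ r.1 ∧ r.1 < β.sizeUpTo (j + 1)

/-- The set `R_{j+1}(α;ρ)`. -/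
noncomputable def rowSet (α : Composition n) (ρ : Equiv.Perm (Fin n)) (j : ℕ) :
    Finset (Fin n) :=
  (block (compl α) j).image ρ

/-- The set `C_{i+1}(α;ρ)`. -/
noncomputable def colSet (ρ : Equiv.Perm (Fin n)) (i : ℕ) : Finset (Fin n) :=
  block (comp (desL ρ)) i

/-- The diagram `D_{α;ρ}`, consisting of the boxes `(i, j)`, with `i, j` counted from `1`, such
that the sets `R_j(α;ρ)` and `C_i(α;ρ)` meet. -/
noncomputable def diagram (α : Composition n) (ρ : Equiv.Perm (Fin n)) : Finset (ℕ × ℕ) :=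
  ((Finset.range (comp (desL ρ)).length ×ˢ Finset.range (compl α).length).filter fun p =>
    (rowSet α ρ p.2 ∩ colSet ρ p.1).Nonempty).image fun p => (p.1 + 1, p.2 + 1)

end HeckePoset

/-!
The common idea is that an equivalence class of tableaux, a left weak order interval and the linear
extensions of a poset of dimension at most two are the same thing.

For a class `E`, write `p ≺ q` for two boxes if every tableau in `E` has a smaller entry at `p` than
at `q` (`Below`). The triple condition implies that two boxes in the same row, in the same
column, or in attacking position are always comparable, and that every filling respecting `≺` is a
tableau of `E` (`exists_srct_of_below`). If the boxes are visited by increasing entry of a source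
tableau `τ`, a step to the left stays in the row and goes to the adjacent column; so a passage from
`p` to a box `q` further left either is a single such step or visits a column in between, and an
induction yields `p ≺ q` (`IsSource.below`). The sink tableau `τ'` is treated in the same way with
steps to the right, which are attacking descents (`IsSink.below`). Therefore a source and a sink
are unique in `E`, and `≺` is the intersection of the two linear orders given by `τ` and `τ'`
(`below_iff`). They exist, as they are given by the extremal numbers of inversions of the column
reading word.

The left weak order is the containment of inversion sets (`leftWeakLE_iff`), whence `[σ, ρ]_L` is
the set of linear extensions of the intersection of the orders of the positions given by `σ` and
`ρ` (`mem_leftInterval_iff`). Reading words thus identify `E` with `[σ, ρ]_L`, and the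
descents of a tableau are the left ascents of its word (`mem_desL_read_iff`), so that the two
actions agree (`act_eq_map_intervalAct`).

For the diagram only the following is used: `σ` reverses the blocks cut out by `Des τ`
(`ReversesBlocks`) and its inversions are inversions of `ρ`. In a block the letters of `ρ`
decrease, whereas between two consecutive left descents of `ρ` the letters occur from left to
right; so a block and a column share at most one letter, the boxes correspond to the positions,
and comparing boxes amounts to comparing positions under both `σ` and `ρ`
(`ReversesBlocks.canonicalPoset_lt_iff`). The right interval in question consists of the inverses
of the linear extensions of this order with the positions reversed. Finally, a poset is determined
by its linear extensions (`linExtR_injective`).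
-/

namespace HeckePoset

open scoped Classical

variable {n : ℕ}

/-! ### Weak order and inversion sets -/

theorem perm_inv_apply_self (σ : Equiv.Perm (Fin n)) (a : Fin n) : σ⁻¹ (σ a) = a :=
  σ.symm_apply_apply a

theorem invSet_subset_s_mul (σ : Equiv.Perm (Fin n)) (i : Fin (n - 1))
    (h : σ⁻¹ (lo i) < σ⁻¹ (hi i)) : invSet σ ⊆ invSet (s i * σ) := by
  rintro ⟨a, b⟩ hab
  rw [mem_invSet] at hab ⊢
  refine ⟨hab.1, SRCT.s_lt_s i hab.2 ?_⟩
  rintro ⟨h1, h2⟩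
  rw [← h1, ← h2, perm_inv_apply_self, perm_inv_apply_self] at h
  exact h.not_gt hab.1

theorem invSet_s_mul_subset (σ ρ : Equiv.Perm (Fin n)) (i : Fin (n - 1))
    (hsub : invSet σ ⊆ invSet ρ) (h : ρ (σ⁻¹ (hi i)) < ρ (σ⁻¹ (lo i))) :
    invSet (s i * σ) ⊆ invSet ρ := by
  rintro ⟨a, b⟩ hab
  rw [mem_invSet, Equiv.Perm.mul_apply, Equiv.Perm.mul_apply] at hab
  rcases lt_trichotomy (σ b) (σ a) with h1 | h1 | h1
  · exact hsub ((mem_invSet _ _ _).2 ⟨hab.1, h1⟩)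
  · exact absurd (σ.injective h1) hab.1.ne'
  · by_cases h2 : σ a = lo i ∧ σ b = hi i
    · rw [mem_invSet]
      refine ⟨hab.1, ?_⟩
      rwa [← h2.1, ← h2.2, perm_inv_apply_self, perm_inv_apply_self] at h
    · exact absurd (SRCT.s_lt_s i h1 h2) hab.2.not_gt

theorem invSet_subset_of_leftWeakLE {σ ρ : Equiv.Perm (Fin n)} (h : LeftWeakLE σ ρ) :
    invSet σ ⊆ invSet ρ := by
  induction h with
  | refl => exact subset_rfl
  | tail _ h ih =>
    obtain ⟨i, hi, rfl⟩ := h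
    rw [mem_desL_iff, not_lt] at hi
    exact ih.trans (invSet_subset_s_mul _ i (lt_of_le_of_ne hi (inv_lo_ne _ i)))

/-- If `σ ≠ ρ`, some simple transposition is an ascent of `σ` whose two letters sit at positions
that are inverted in `ρ`, and one can climb from `σ` along it. -/
theorem leftWeakLE_of_invSet_subset (k : ℕ) : ∀ σ ρ : Equiv.Perm (Fin n),
    (invSet ρ).card ≤ (invSet σ).card + k → invSet σ ⊆ invSet ρ → LeftWeakLE σ ρ := by
  have key : ∀ σ ρ : Equiv.Perm (Fin n), σ ≠ ρ → invSet σ ⊆ invSet ρ →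
      ∃ i, i ∉ desL σ ∧ invSet (s i * σ) ⊆ invSet ρ ∧
        (invSet (s i * σ)).card = (invSet σ).card + 1 := by
    intro σ ρ hne hsub
    obtain ⟨i, h⟩ := exists_inv_hi_lt (σ * ρ⁻¹) fun h => hne (mul_inv_eq_one.1 h)
    rw [mul_inv_rev, inv_inv, Equiv.Perm.mul_apply, Equiv.Perm.mul_apply] at h
    have hlt : σ⁻¹ (lo i) < σ⁻¹ (hi i) := by
      refine lt_of_le_of_ne (not_lt.1 fun hlt => ?_) (inv_lo_ne σ i)
      have := (mem_invSet ρ _ _).1 (hsub ((mem_invSet σ _ _).2 ⟨hlt, by simpa using lo_lt_hi i⟩))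
      exact this.2.not_gt h
    exact ⟨i, by rw [mem_desL_iff]; exact hlt.not_gt, invSet_s_mul_subset σ ρ i hsub h,
      invSet_s_mul σ i hlt⟩
  induction k with
  | zero =>
    intro σ ρ hc hsub
    by_cases hne : σ = ρ
    · exact hne ▸ Relation.ReflTransGen.refl
    · obtain ⟨i, -, h2, h3⟩ := key σ ρ hne hsub
      have := Finset.card_le_card h2
      omega
  | succ k ih =>
    intro σ ρ hc hsub
    by_cases hne : σ = ρ
    · exact hne ▸ Relation.ReflTransGen.refl
    · obtain ⟨i, h1, h2, h3⟩ := key σ ρ hne hsub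
      exact Relation.ReflTransGen.head ⟨i, h1, rfl⟩ (ih _ _ (by omega) h2)

theorem leftWeakLE_iff {σ ρ : Equiv.Perm (Fin n)} :
    LeftWeakLE σ ρ ↔ invSet σ ⊆ invSet ρ :=
  ⟨invSet_subset_of_leftWeakLE, leftWeakLE_of_invSet_subset _ σ ρ (Nat.le_add_left _ _)⟩

/-- A left weak order interval `[σ, ρ]` consists of the linear extensions of the intersection of
the two linear orders on the positions that are given by `σ` and `ρ`. -/
theorem mem_leftInterval_iff {σ ρ : Equiv.Perm (Fin n)} (h : invSet σ ⊆ invSet ρ)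
    (γ : Equiv.Perm (Fin n)) :
    γ ∈ leftInterval σ ρ ↔ ∀ a b, σ a < σ b → ρ a < ρ b → γ a < γ b := by
  have hin : ∀ {a b}, a < b → σ b < σ a → ρ b < ρ a := fun h1 h2 =>
    ((mem_invSet ρ _ _).1 (h ((mem_invSet σ _ _).2 ⟨h1, h2⟩))).2
  have hne : ∀ (δ : Equiv.Perm (Fin n)) {a b}, a < b → ¬ δ b < δ a → δ a < δ b :=
    fun δ a b h1 h2 => lt_of_le_of_ne (not_lt.1 h2) fun e => h1.ne (δ.injective e)
  unfold leftInterval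
  rw [Set.mem_ofPred_eq, leftWeakLE_iff, leftWeakLE_iff]
  constructor
  · rintro ⟨h1, h2⟩ a b hs hr
    rcases lt_trichotomy a b with hab | rfl | hab
    · refine hne γ hab fun hg => ?_
      exact ((mem_invSet _ _ _).1 (h2 ((mem_invSet γ _ _).2 ⟨hab, hg⟩))).2.not_gt hr
    · exact absurd hs (lt_irrefl _)
    · exact ((mem_invSet _ _ _).1 (h1 ((mem_invSet σ _ _).2 ⟨hab, hs⟩))).2
  · intro hg
    constructor
    · rintro ⟨a, b⟩ hab
      rw [mem_invSet] at hab ⊢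
      exact ⟨hab.1, hg _ _ hab.2 (hin hab.1 hab.2)⟩
    · rintro ⟨a, b⟩ hab
      rw [mem_invSet] at hab ⊢
      refine ⟨hab.1, by_contra fun hr => ?_⟩
      have hr' := hne ρ hab.1 hr
      have hs : σ a < σ b := hne σ hab.1 fun hs => hr (hin hab.1 hs)
      exact (hg _ _ hs hr').not_gt hab.2

theorem length_inv_le (σ : Equiv.Perm (Fin n)) : length σ⁻¹ ≤ length σ := by
  obtain ⟨l, hl, rfl⟩ := exists_word _ σ rfl
  rw [length_eq_card_invSet (List.prod _), ← hl]
  refine Nat.sInf_le ⟨l.reverse, l.length_reverse, ?_⟩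
  rw [List.prod_inv_reverse, List.map_map, List.map_reverse]
  congr 3

theorem length_inv (σ : Equiv.Perm (Fin n)) : length σ⁻¹ = length σ :=
  le_antisymm (length_inv_le σ) (by simpa using length_inv_le σ⁻¹)

theorem mem_desR_iff (σ : Equiv.Perm (Fin n)) (i : Fin (n - 1)) : i ∈ desR σ ↔ i ∈ desL σ⁻¹ := by
  simp only [desL, desR, Finset.mem_filter, Finset.mem_univ, true_and]
  rw [← length_inv σ, ← length_inv (σ * s i), mul_inv_rev, s_inv]

theorem RightWeakLE.inv {σ ρ : Equiv.Perm (Fin n)} (h : RightWeakLE σ ρ) :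
    LeftWeakLE σ⁻¹ ρ⁻¹ := by
  refine Relation.ReflTransGen.lift (fun γ : Equiv.Perm (Fin n) => γ⁻¹) ?_ _ _ h
  rintro _ _ ⟨i, hi, rfl⟩
  exact ⟨i, by rwa [mem_desR_iff] at hi, by simp only [mul_inv_rev, s_inv]⟩

theorem LeftWeakLE.inv {σ ρ : Equiv.Perm (Fin n)} (h : LeftWeakLE σ ρ) :
    RightWeakLE σ⁻¹ ρ⁻¹ := by
  refine Relation.ReflTransGen.lift (fun γ : Equiv.Perm (Fin n) => γ⁻¹) ?_ _ _ h
  rintro _ _ ⟨i, hi, rfl⟩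
  exact ⟨i, by rwa [mem_desR_iff, inv_inv], by simp only [mul_inv_rev, s_inv]⟩

theorem mem_rightInterval_iff (σ ρ γ : Equiv.Perm (Fin n)) :
    γ ∈ rightInterval σ ρ ↔ γ⁻¹ ∈ leftInterval σ⁻¹ ρ⁻¹ :=
  ⟨fun h => ⟨h.1.inv, h.2.inv⟩, fun h => ⟨by simpa using h.1.inv, by simpa using h.2.inv⟩⟩

/-- Multiplying by `w0` on the left before inverting reverses the positions, which exchanges the
roles of the two ends of the interval. -/
theorem mem_rightInterval_w0_iff {σ ρ : Equiv.Perm (Fin n)} (h : invSet σ ⊆ invSet ρ)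
    (γ : Equiv.Perm (Fin n)) :
    γ ∈ rightInterval (w0 * ρ⁻¹) (w0 * σ⁻¹) ↔
      ∀ i j, σ i.rev < σ j.rev → ρ i.rev < ρ j.rev → γ⁻¹ i < γ⁻¹ j := by
  have e : ∀ (δ : Equiv.Perm (Fin n)) (i : Fin n),
      (w0 * δ⁻¹ : Equiv.Perm (Fin n))⁻¹ i = δ i.rev := by
    intro δ i
    rw [mul_inv_rev, inv_inv, Equiv.Perm.mul_apply]
    rfl
  rw [mem_rightInterval_iff, mem_leftInterval_iff]
  · simp only [e]
    exact ⟨fun h i j h1 h2 => h i j h2 h1, fun h i j h1 h2 => h i j h2 h1⟩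
  · rintro ⟨a, b⟩ hab
    rw [mem_invSet] at hab ⊢
    simp only [e] at hab ⊢
    refine ⟨hab.1, ?_⟩
    have hab' : b.rev < a.rev := Fin.rev_lt_rev.2 hab.1
    refine lt_of_le_of_ne (not_lt.1 fun hlt => ?_) fun e => hab'.ne (σ.injective e)
    exact ((mem_invSet _ _ _).1 (h ((mem_invSet σ _ _).2 ⟨hab', hlt⟩))).2.not_gt hab.2

/-! ### Posets and their linear extensions -/

/-- Enumeration along a linear order. It is stated for a general type, as `Fin n` already carries
another order. -/
theorem exists_equiv_of_isLinearOrder {X : Type} [Fintype X] (t : X → X → Prop)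
    (ht : IsLinearOrder X t) (h : Fintype.card X = n) :
    ∃ e : Fin n ≃ X, ∀ x y, t x y → x ≠ y → e.symm x < e.symm y := by
  let L : LinearOrder X :=
    { le := t, le_refl := ht.refl, le_trans := ht.trans, le_antisymm := ht.antisymm
      le_total := ht.total, toDecidableLE := Classical.decRel _ }
  let e := monoEquivOfFin X h
  exact ⟨e.toEquiv, fun x y h1 h2 =>
    lt_of_le_of_ne (e.symm.monotone h1) fun h => h2 (e.symm.injective h)⟩

/-- Any two elements `i`, `j` with `i ≰ j` can be listed with `j` before `i`: extend the
partial order first by `j < i` and then to a linear order. -/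
theorem exists_linExtR_lt (P : PartialOrder (Fin n)) (i j : Fin n) (hij : ¬ P.le i j) :
    ∃ γ ∈ linExtR P, γ⁻¹ j < γ⁻¹ i := by
  let r : Fin n → Fin n → Prop := fun x y => P.le x y ∨ (P.le x j ∧ P.le i y)
  have hr : IsPartialOrder (Fin n) r :=
    { refl := fun x => Or.inl (P.le_refl x)
      trans := by
        rintro x y z (h1 | h1) (h2 | h2)
        · exact Or.inl (P.le_trans _ _ _ h1 h2)
        · exact Or.inr ⟨P.le_trans _ _ _ h1 h2.1, h2.2⟩
        · exact Or.inr ⟨h1.1, P.le_trans _ _ _ h1.2 h2⟩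
        · exact Or.inr ⟨h1.1, h2.2⟩
      antisymm := by
        rintro x y (h1 | h1) (h2 | h2)
        · exact P.le_antisymm _ _ h1 h2
        · exact absurd (P.le_trans _ _ _ h2.2 (P.le_trans _ _ _ h1 h2.1)) hij
        · exact absurd (P.le_trans _ _ _ h1.2 (P.le_trans _ _ _ h2 h1.1)) hij
        · exact absurd (P.le_trans _ _ _ h1.2 h2.1) hij }
  obtain ⟨t, ht, hrt⟩ := extend_partialOrder r
  obtain ⟨e, he⟩ := exists_equiv_of_isLinearOrder t ht (Fintype.card_fin n)
  refine ⟨e, fun x y hxy => ?_, ?_⟩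
  · have hxy' := (P.lt_iff_le_not_ge x y).1 hxy
    exact he x y (hrt _ _ (Or.inl hxy'.1)) fun h => hxy'.2 (h ▸ P.le_refl _)
  · exact he j i (hrt _ _ (Or.inr ⟨P.le_refl _, P.le_refl _⟩)) fun h => hij (h ▸ P.le_refl _)

theorem linExtR_injective : Function.Injective (linExtR : PartialOrder (Fin n) → _) := by
  have key : ∀ P P' : PartialOrder (Fin n), linExtR P = linExtR P' →
      ∀ i j, P.le i j → P'.le i j := by
    intro P P' h i j hij
    by_contra hc
    obtain ⟨γ, hγ, hlt⟩ := exists_linExtR_lt P' i j hc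
    rw [← h] at hγ
    have hne : i ≠ j := fun e => hc (e ▸ P'.le_refl _)
    exact Nat.lt_asymm hlt (hγ i j ((P.lt_iff_le_not_ge i j).2
      ⟨hij, fun h' => hne (P.le_antisymm _ _ hij h')⟩))
  intro P P' h
  apply PartialOrder.ext
  exact fun i j => ⟨key P P' h i j, key P' P h.symm i j⟩

/-! ### Blocks of compositions -/

theorem setOf_comp (I : Finset (Fin (n - 1))) : setOf (comp I) = I := by
  simp [setOf, comp]

theorem compl_comp_compl (I : Finset (Fin (n - 1))) : compl (comp Iᶜ) = comp I := by
  rw [compl, setOf_comp, compl_compl]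

theorem mem_setOf (β : Composition n) (i : Fin (n - 1)) :
    i ∈ setOf β ↔ ∃ m, β.sizeUpTo m = i.1 + 1 := by
  have h : i ∈ setOf β ↔ (⟨1 + i.1, by omega⟩ : Fin (n + 1)) ∈ β.boundaries := by
    simp [setOf, compositionAsSetEquiv, compositionEquiv, Composition.toCompositionAsSet]
  rw [h]
  simp only [Composition.boundaries, Finset.mem_map, Finset.mem_univ, true_and]
  constructor
  · rintro ⟨m, hm⟩
    refine ⟨m.1, ?_⟩
    have := congrArg Fin.val hm
    simp only [Composition.boundary] at this
    exact this.trans (Nat.add_comm _ _)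
  · rintro ⟨m, hm⟩
    have hlt : m < β.length + 1 := by
      by_contra hc
      rw [β.sizeUpTo_ofLength_le m (by omega)] at hm
      have := i.2
      omega
    refine ⟨⟨m, hlt⟩, Fin.ext ?_⟩
    exact hm.trans (Nat.add_comm _ _)

theorem mem_block_iff (β : Composition n) (j : ℕ) (r : Fin n) :
    r ∈ block β j ↔ (β.index r).1 = j := by
  have h1 := β.sizeUpTo_index_le r
  have h2 := β.lt_sizeUpTo_index_succ r
  rw [Fin.val_succ] at h2
  simp only [block, Finset.mem_filter, Finset.mem_univ, true_and]
  constructor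
  · rintro ⟨h3, h4⟩
    rcases lt_trichotomy (β.index r).1 j with h | h | h
    · have := β.monotone_sizeUpTo (Nat.succ_le_of_lt h)
      simp only [Nat.succ_eq_add_one] at this
      omega
    · exact h
    · have := β.monotone_sizeUpTo (Nat.succ_le_of_lt h)
      simp only [Nat.succ_eq_add_one] at this
      omega
  · rintro rfl
    exact ⟨h1, h2⟩

theorem index_lt_iff (β : Composition n) (a b : Fin n) :
    β.index a < β.index b ↔ ∃ i ∈ setOf β, a.1 ≤ i.1 ∧ i.1 < b.1 := by
  have ha1 := β.sizeUpTo_index_le a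
  have ha2 := β.lt_sizeUpTo_index_succ a
  have hb1 := β.sizeUpTo_index_le b
  have hb2 := β.lt_sizeUpTo_index_succ b
  rw [Fin.val_succ] at ha2 hb2
  constructor
  · intro h
    have h3 := β.monotone_sizeUpTo (Nat.succ_le_of_lt h)
    simp only [Nat.succ_eq_add_one] at h3
    have := b.2
    refine ⟨⟨β.sizeUpTo ((β.index a).1 + 1) - 1, by omega⟩, (mem_setOf _ _).2
      ⟨(β.index a).1 + 1, ?_⟩, ?_, ?_⟩ <;> simp only <;> omega
  · rintro ⟨i, hi, h1, h2⟩
    obtain ⟨m, hm⟩ := (mem_setOf _ _).1 hi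
    have h3 : (β.index a).1 < m := by
      by_contra hc
      have := β.monotone_sizeUpTo (not_lt.1 hc)
      omega
    have h4 : m ≤ (β.index b).1 := by
      by_contra hc
      have := β.monotone_sizeUpTo (Nat.succ_le_of_lt (not_le.1 hc))
      simp only [Nat.succ_eq_add_one] at this
      omega
    exact Fin.lt_def.2 (lt_of_lt_of_le h3 h4)

theorem index_monotone (β : Composition n) : Monotone β.index := by
  intro a b hab
  by_contra hc
  obtain ⟨i, -, h1, h2⟩ := (index_lt_iff β b a).1 (not_le.1 hc)
  have : a.1 ≤ b.1 := hab
  omega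

theorem index_surjective (β : Composition n) : Function.Surjective β.index := fun i =>
  ⟨β.embedding i ⟨0, β.one_le_blocksFun i⟩, β.index_embedding _ _⟩

/-- The letters of a block between two consecutive left descents occur from left to right. -/
theorem inv_lt_inv_of_index_eq (ρ : Equiv.Perm (Fin n)) {x y : Fin n} (hxy : x < y)
    (h : (comp (desL ρ)).index x = (comp (desL ρ)).index y) : ρ⁻¹ x < ρ⁻¹ y := by
  have hno : ∀ i : Fin (n - 1), x.1 ≤ i.1 → i.1 < y.1 → ρ⁻¹ (lo i) < ρ⁻¹ (hi i) := by
    intro i h1 h2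
    refine lt_of_le_of_ne (not_lt.1 fun h3 => ?_) (inv_lo_ne ρ i)
    refine h.not_lt ((index_lt_iff _ x y).2 ⟨i, ?_, h1, h2⟩)
    rw [setOf_comp]
    exact (mem_desL_iff ρ i).2 h3
  obtain ⟨k, hk⟩ : ∃ k, y.1 = x.1 + (k + 1) := ⟨y.1 - x.1 - 1, by
    have : x.1 < y.1 := hxy
    omega⟩
  clear h hxy
  induction k generalizing y with
  | zero =>
    have := y.2
    have h := hno ⟨x.1, by omega⟩ le_rfl (by simp only; omega)
    rwa [show lo ⟨x.1, _⟩ = x from rfl, show hi ⟨x.1, _⟩ = y from Fin.ext hk.symm] at h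
  | succ k ih =>
    have := y.2
    have h1 := @ih ⟨x.1 + (k + 1), by omega⟩ (fun i h1 h2 => hno i h1 (by simp only at h2; omega))
      rfl
    have h := hno ⟨x.1 + (k + 1), by omega⟩ (by simp only; omega) (by simp only; omega)
    rw [show hi ⟨x.1 + (k + 1), _⟩ = y from Fin.ext hk.symm] at h
    exact h1.trans h

/-! ### The diagram of an interval -/

/-- The box of `D_{α;ρ}` (for `α` with complement `comp I`) containing the letter at position `r`
of `ρ`. -/
noncomputable def boxAt (I : Finset (Fin (n - 1))) (ρ : Equiv.Perm (Fin n)) (r : Fin n) : ℕ × ℕ :=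
  (((comp (desL ρ)).index (ρ r)).1 + 1, ((comp I).index r).1 + 1)

theorem diagram_eq_image (I : Finset (Fin (n - 1))) (ρ : Equiv.Perm (Fin n)) :
    diagram (comp Iᶜ) ρ = Finset.univ.image (boxAt I ρ) := by
  ext p
  simp only [diagram, Finset.mem_image, Finset.mem_filter, Finset.mem_product, Finset.mem_range,
    Finset.mem_univ, true_and, rowSet, colSet, compl_comp_compl]
  constructor
  · rintro ⟨⟨i, j⟩, ⟨-, x, hx⟩, rfl⟩
    rw [Finset.mem_inter, Finset.mem_image] at hx
    obtain ⟨⟨r, hr, rfl⟩, hx⟩ := hx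
    rw [mem_block_iff] at hr hx
    exact ⟨r, by simp only [boxAt, hr, hx]⟩
  · rintro ⟨r, rfl⟩
    refine ⟨(((comp (desL ρ)).index (ρ r)).1, ((comp I).index r).1),
      ⟨⟨Fin.is_lt _, Fin.is_lt _⟩, ρ r, ?_⟩, rfl⟩
    rw [Finset.mem_inter, Finset.mem_image]
    exact ⟨⟨r, (mem_block_iff _ _ _).2 rfl, rfl⟩, (mem_block_iff _ _ _).2 rfl⟩

theorem image_succ_of_surjective {X : Type} [Fintype X] {k : ℕ} (f : X → Fin k)
    (hf : Function.Surjective f) :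
    Finset.univ.image (fun x => (f x).1 + 1) = Finset.Icc 1 k := by
  ext y
  simp only [Finset.mem_image, Finset.mem_univ, true_and, Finset.mem_Icc]
  constructor
  · rintro ⟨x, rfl⟩
    exact ⟨Nat.le_add_left _ _, (f x).2⟩
  · rintro ⟨h1, h2⟩
    obtain ⟨x, hx⟩ := hf ⟨y - 1, by omega⟩
    exact ⟨x, by rw [hx]; simp only; omega⟩

/-- The permutation `σ` is the longest element of the Young subgroup whose blocks are cut out by
`I`: every block is reversed and different blocks stay in increasing order. -/
def ReversesBlocks (I : Finset (Fin (n - 1))) (σ : Equiv.Perm (Fin n)) : Prop :=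
  ∀ a b, σ a < σ b ↔ (comp I).index a < (comp I).index b ∨
    ((comp I).index a = (comp I).index b ∧ b < a)

section Interval

variable {I : Finset (Fin (n - 1))} {σ ρ : Equiv.Perm (Fin n)}

theorem ReversesBlocks.apply_lt (hσ : ReversesBlocks I σ) (h : invSet σ ⊆ invSet ρ) {a b : Fin n}
    (hab : a < b) (he : (comp I).index a = (comp I).index b) : ρ b < ρ a :=
  ((mem_invSet ρ a b).1 (h ((mem_invSet σ a b).2
    ⟨hab, (hσ b a).2 (Or.inr ⟨he.symm, hab⟩)⟩))).2

/-- The boxes of one row of the diagram come from right to left, since the letters of `ρ` in that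
block are decreasing while the letters in one column are increasing. -/
theorem ReversesBlocks.col_lt (hσ : ReversesBlocks I σ) (h : invSet σ ⊆ invSet ρ) {a b : Fin n}
    (hab : a < b) (he : (comp I).index a = (comp I).index b) :
    (comp (desL ρ)).index (ρ b) < (comp (desL ρ)).index (ρ a) := by
  have h1 := hσ.apply_lt h hab he
  refine lt_of_le_of_ne (index_monotone _ h1.le) fun he' => ?_
  have := inv_lt_inv_of_index_eq ρ h1 he'
  rw [perm_inv_apply_self, perm_inv_apply_self] at this
  exact this.not_gt hab

theorem ReversesBlocks.boxAt_injective (hσ : ReversesBlocks I σ) (h : invSet σ ⊆ invSet ρ) :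
    Function.Injective (boxAt I ρ) := by
  intro a b hab
  have h1 : (comp (desL ρ)).index (ρ a) = (comp (desL ρ)).index (ρ b) :=
    Fin.ext (Nat.succ_injective (congrArg Prod.fst hab))
  have h2 : (comp I).index a = (comp I).index b :=
    Fin.ext (Nat.succ_injective (congrArg Prod.snd hab))
  rcases lt_trichotomy a b with h3 | h3 | h3
  · exact absurd h1.symm (hσ.col_lt h h3 h2).ne
  · exact h3
  · exact absurd h1 (hσ.col_lt h h3 h2.symm).ne

theorem ReversesBlocks.isDiagram (hσ : ReversesBlocks I σ) (h : invSet σ ⊆ invSet ρ) :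
    IsDiagram n (diagram (comp Iᶜ) ρ) := by
  rw [diagram_eq_image]
  refine ⟨?_, ⟨(comp I).length, ?_⟩, (comp (desL ρ)).length, ?_⟩
  · rw [Finset.card_image_of_injective _ (hσ.boxAt_injective h), Finset.card_univ,
      Fintype.card_fin]
  · rw [Finset.image_image]
    exact image_succ_of_surjective _ (index_surjective (comp I))
  · rw [Finset.image_image]
    exact image_succ_of_surjective (fun r => (comp (desL ρ)).index (ρ r))
      ((index_surjective _).comp ρ.surjective)

/-- Listing the boxes row by row from the top amounts to listing the positions of `ρ`
backwards. -/
theorem ReversesBlocks.boxOrder_eq (hσ : ReversesBlocks I σ) (h : invSet σ ⊆ invSet ρ)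
    (hc : (diagram (comp Iᶜ) ρ).card = n) (k : Fin n) :
    (boxOrder (diagram (comp Iᶜ) ρ) hc k : ℕ × ℕ) = boxAt I ρ k.rev := by
  set D := diagram (comp Iᶜ) ρ with hD
  have hmem : ∀ r, boxAt I ρ r ∈ D := fun r => by
    rw [hD, diagram_eq_image]
    exact Finset.mem_image_of_mem _ (Finset.mem_univ r)
  let f : Fin n → ↥D := fun k => ⟨boxAt I ρ k.rev, hmem _⟩
  have hf : StrictMono (boxKey D ∘ f) := by
    intro k l hkl
    have hr : l.rev < k.rev := Fin.rev_lt_rev.2 hkl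
    refine Prod.Lex.toLex_lt_toLex.2 ?_
    rcases (index_monotone (comp I) hr.le).lt_or_eq with h1 | h1
    · exact Or.inl (Nat.succ_lt_succ h1)
    · refine Or.inr ⟨?_, Nat.succ_lt_succ (hσ.col_lt h hr h1)⟩
      simp only [f, boxAt, h1]
  have hg : StrictMono (boxKey D ∘ boxOrder D hc) := fun k l hkl =>
    (boxKey_boxOrder_lt D hc k l).2 hkl
  have hfs : Function.Surjective f := by
    rintro ⟨d, hd⟩
    have hd' := hd
    rw [hD, diagram_eq_image, Finset.mem_image] at hd'
    obtain ⟨r, -, rfl⟩ := hd'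
    exact ⟨r.rev, Subtype.ext (by simp only [f, Fin.rev_rev])⟩
  have := (hg.range_inj hf).1 (by
    rw [hfs.range_comp, (boxOrder D hc).surjective.range_comp])
  exact congrArg Subtype.val (boxKey_injective D (congrFun this k))

theorem ReversesBlocks.canonicalPoset_lt_iff (hσ : ReversesBlocks I σ) (h : invSet σ ⊆ invSet ρ)
    (hD : IsDiagram n (diagram (comp Iᶜ) ρ)) (i j : Fin n) :
    (canonicalPoset _ hD).lt i j ↔ σ i.rev < σ j.rev ∧ ρ i.rev < ρ j.rev := by
  have hle : ∀ i j, (canonicalPoset _ hD).le i j ↔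
      (comp (desL ρ)).index (ρ i.rev) ≤ (comp (desL ρ)).index (ρ j.rev) ∧
        (comp I).index i.rev ≤ (comp I).index j.rev := by
    intro i j
    rw [canonicalPoset_le_iff, hσ.boxOrder_eq h, hσ.boxOrder_eq h]
    exact and_congr Nat.succ_le_succ_iff Nat.succ_le_succ_iff
  have hlt : (canonicalPoset _ hD).lt i j ↔ (canonicalPoset _ hD).le i j ∧ i ≠ j := by
    rw [(canonicalPoset _ hD).lt_iff_le_not_ge]
    refine and_congr_right fun h1 => not_congr ⟨fun h2 => ?_, fun h2 => ?_⟩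
    · exact (canonicalPoset _ hD).le_antisymm _ _ h1 h2
    · exact h2 ▸ (canonicalPoset _ hD).le_refl _
  rw [hlt, hle]
  set a := i.rev
  set b := j.rev
  have hcol : ∀ {x y : Fin n}, ρ x < ρ y →
      (comp (desL ρ)).index (ρ y) ≤ (comp (desL ρ)).index (ρ x) → x < y := by
    intro x y h1 h2
    have := inv_lt_inv_of_index_eq ρ h1 (le_antisymm (index_monotone _ h1.le) h2)
    rwa [perm_inv_apply_self, perm_inv_apply_self] at this
  constructor
  · rintro ⟨⟨h1, h2⟩, hne⟩
    have hne' : a ≠ b := fun e => hne (Fin.rev_injective e)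
    rcases h2.lt_or_eq with h3 | h3
    · have hab : a < b := not_le.1 fun hba => h3.not_ge (index_monotone _ hba)
      refine ⟨(hσ a b).2 (Or.inl h3), lt_of_le_of_ne (not_lt.1 fun h4 => ?_)
        fun e => hne' (ρ.injective e)⟩
      exact (hcol h4 h1).not_gt hab
    · have hba : b < a := by
        refine lt_of_le_of_ne (not_lt.1 fun hab => ?_) hne'.symm
        exact (hσ.col_lt h hab h3).not_ge h1
      exact ⟨(hσ a b).2 (Or.inr ⟨h3, hba⟩), hσ.apply_lt h hba h3.symm⟩
  · rintro ⟨h1, h2⟩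
    refine ⟨⟨index_monotone _ h2.le, ?_⟩, ?_⟩
    · rcases (hσ a b).1 h1 with h3 | h3
      exacts [h3.le, h3.1.le]
    · rintro rfl
      exact lt_irrefl _ h1

theorem ReversesBlocks.linExtR_canonicalPoset (hσ : ReversesBlocks I σ)
    (h : invSet σ ⊆ invSet ρ) (hD : IsDiagram n (diagram (comp Iᶜ) ρ)) :
    linExtR (canonicalPoset _ hD) = rightInterval (w0 * ρ⁻¹) (w0 * σ⁻¹) := by
  ext γ
  rw [mem_rightInterval_w0_iff h]
  change (∀ i j, (canonicalPoset _ hD).lt i j → γ⁻¹ i < γ⁻¹ j) ↔ _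
  simp only [hσ.canonicalPoset_lt_iff h hD, and_imp]

end Interval

namespace SRCT

variable {α : Composition n} {τ τ₀ τ₁ : SRCT α}

/-! ### Equivalence classes of tableaux as sets of linear extensions -/

theorem entry_lt_or_lt (τ : SRCT α) {p q : Cell α} (h : p ≠ q) :
    τ.entry p < τ.entry q ∨ τ.entry q < τ.entry p :=
  lt_or_gt_of_ne fun e => h (τ.entry.injective e)

theorem std_le_std_iff (τ : SRCT α) {p q : Cell α} (hc : p.col = q.col) :
    τ.std p ≤ τ.std q ↔ τ.entry p ≤ τ.entry q := by
  constructor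
  · intro h
    by_contra hlt
    refine h.not_gt (Finset.card_lt_card ?_)
    rw [Finset.ssubset_iff_of_subset]
    · exact ⟨p, Finset.mem_filter.2 ⟨Finset.mem_univ _, rfl, le_rfl⟩,
        fun h' => hlt (Finset.mem_filter.1 h').2.2⟩
    · intro x hx
      rw [Finset.mem_filter] at hx ⊢
      exact ⟨hx.1, hx.2.1.trans hc.symm, hx.2.2.trans (not_le.1 hlt).le⟩
  · intro h
    refine Finset.card_le_card fun x hx => ?_
    rw [Finset.mem_filter] at hx ⊢
    exact ⟨hx.1, hx.2.1.trans hc, hx.2.2.trans h⟩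

/-- Two tableaux are equivalent iff their entries are in the same relative order within every
column. -/
theorem toClass_eq_iff : τ₁.toClass = τ.toClass ↔
    ∀ p q : Cell α, p.col = q.col → τ.entry p < τ.entry q → τ₁.entry p < τ₁.entry q := by
  unfold toClass
  rw [Quotient.eq]
  change (∀ p, τ₁.std p = τ.std p) ↔ _
  constructor
  · intro h p q hc hlt
    rw [← not_le, ← std_le_std_iff τ₁ hc.symm, h, h, std_le_std_iff τ hc.symm, not_le]
    exact hlt
  · intro h p
    unfold std
    congr 1
    ext q
    simp only [Finset.mem_filter, Finset.mem_univ, true_and, and_congr_right_iff]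
    intro hc
    constructor
    · intro h1
      exact not_lt.1 fun h2 => h1.not_gt (h p q hc.symm h2)
    · intro h1
      rcases h1.lt_or_eq with h2 | h2
      · exact (h q p hc h2).le
      · rw [τ.entry.injective h2]

/-- The order on the boxes shared by all tableaux of the class of `τ`. -/
def Below (τ : SRCT α) (p q : Cell α) : Prop :=
  ∀ τ₁ : SRCT α, τ₁.toClass = τ.toClass → τ₁.entry p < τ₁.entry q

theorem Below.trans {p q r : Cell α} (h1 : Below τ p q) (h2 : Below τ q r) : Below τ p r :=
  fun τ₁ h => (h1 τ₁ h).trans (h2 τ₁ h)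

theorem below_congr (h : τ₁.toClass = τ.toClass) {p q : Cell α} : Below τ₁ p q ↔ Below τ p q := by
  unfold Below
  rw [h]

theorem below_of_col_eq {p q : Cell α} (hc : p.col = q.col) (h : τ.entry p < τ.entry q) :
    Below τ p q := fun _ h1 => toClass_eq_iff.1 h1 p q hc h

theorem below_of_row_eq {p q : Cell α} (hr : p.row = q.row) (hc : q.col < p.col) :
    Below τ p q := fun τ₁ _ => τ₁.row_decreasing q p hr.symm hc

/-- If a smaller entry attacks a larger one, then the same holds throughout the class: otherwise
the triple condition would produce a box changing the order in a column. -/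
theorem below_of_attacks {p q : Cell α} (ha : Attacks p q) (h : τ.entry p < τ.entry q) :
    Below τ p q := by
  rcases ha with hc | ⟨hc, hr⟩
  · exact below_of_col_eq hc h
  · intro τ₁ h1
    have hne : p ≠ q := by rintro rfl; exact hr.ne rfl
    refine (τ₁.entry_lt_or_lt hne).resolve_right fun h2 => ?_
    obtain ⟨t, ht1, ht2, ht3⟩ := τ₁.triple p q hr hc h2
    have h3 := toClass_eq_iff.1 h1.symm q t ht2.symm ht3
    have h4 := τ.row_decreasing p t ht1.symm (by omega)
    exact (h.trans h3).not_gt h4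

/-- Only pairs of boxes in one row or in attacking position matter for being a tableau of a given
class. -/
theorem exists_srct_of_fill (τ : SRCT α) (e : Cell α ≃ Fin n)
    (he : ∀ p q : Cell α, (Attacks p q ∨ (p.row = q.row ∧ q.col < p.col)) →
      τ.entry p < τ.entry q → e p < e q) :
    ∃ τ₁ : SRCT α, τ₁.entry = e ∧ τ₁.toClass = τ.toClass := by
  refine ⟨⟨e, ?_, ?_, ?_⟩, rfl, ?_⟩
  · intro p q hr hc
    exact he q p (Or.inr ⟨hr.symm, hc⟩) (τ.row_decreasing p q hr hc)
  · intro p q hp hq hr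
    exact he p q (Or.inl (Or.inl (hp.trans hq.symm))) (τ.col_increasing p q hp hq hr)
  · intro p q hr hc h
    have hne : p ≠ q := by rintro rfl; exact hr.ne rfl
    have h1 : τ.entry q < τ.entry p := (τ.entry_lt_or_lt hne).resolve_left fun h1 =>
      (he p q (Or.inl (Or.inr ⟨hc, hr⟩)) h1).not_gt h
    obtain ⟨t, ht1, ht2, ht3⟩ := τ.triple p q hr hc h1
    exact ⟨t, ht1, ht2, he q t (Or.inl (Or.inl ht2.symm)) ht3⟩
  · exact toClass_eq_iff.2 fun p q hc h => he p q (Or.inl (Or.inl hc)) h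

/-- The fillings respecting the common order of a class are the tableaux of the class. -/
theorem exists_srct_of_below (τ : SRCT α) (e : Cell α ≃ Fin n)
    (he : ∀ p q, Below τ p q → e p < e q) :
    ∃ τ₁ : SRCT α, τ₁.entry = e ∧ τ₁.toClass = τ.toClass := by
  refine τ.exists_srct_of_fill e fun p q h1 h2 => he p q ?_
  rcases h1 with h1 | h1
  · exact below_of_attacks h1 h2
  · exact below_of_row_eq h1.1 h1.2

/-! ### Source and sink tableaux -/

theorem mem_Des_iff (τ : SRCT α) (i : Fin (n - 1)) :
    i ∈ τ.Des ↔ (τ.pos (lo i)).col ≤ (τ.pos (hi i)).col := by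
  simp [Des]

theorem entry_pos (τ : SRCT α) (v : Fin n) : τ.entry (τ.pos v) = v :=
  τ.entry.apply_symm_apply v

/-- Follow the boxes of `τ` by increasing entry. If a height function `f` never increases by more
than one in a step, then the boxes visited between `p` and a higher box `q` include one of
intermediate height, unless `q` comes right after `p`. Hence a transitive relation `B` that
contains the steps upwards and the pairs of equal height contains all pairs going upwards. -/
theorem rel_of_height_lt (τ : SRCT α) (f : Cell α → ℤ) (B : Cell α → Cell α → Prop)
    (htrans : ∀ x y z, B x y → B y z → B x z)
    (heq : ∀ x y, τ.entry x < τ.entry y → f x = f y → B x y)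
    (hstep : ∀ x y, (τ.entry y).1 = (τ.entry x).1 + 1 → f x < f y → f y = f x + 1 ∧ B x y)
    (k : ℕ) : ∀ p q, (τ.entry q).1 = (τ.entry p).1 + (k + 1) → f p < f q →
      B p q ∧ (k = 0 ∨ ∃ x, B p x ∧ B x q) := by
  induction k using Nat.strong_induction_on with
  | _ k ih =>
    intro p q hpq hf
    rcases Nat.eq_zero_or_pos k with rfl | hk
    · exact ⟨(hstep p q hpq hf).2, Or.inl rfl⟩
    obtain ⟨x, h1, h2, h3, h4⟩ : ∃ x, (τ.entry p).1 < (τ.entry x).1 ∧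
        (τ.entry x).1 < (τ.entry q).1 ∧ f p ≤ f x ∧ f x ≤ f q := by
      -- Otherwise the boxes before `q` stay at height at most `f p`, because a step upwards from
      -- there reaches at most `f p + 1 ≤ f q`; the last step to `q` is then impossible.
      by_contra! H
      have hlow : ∀ m ≤ k, ∀ x, (τ.entry x).1 = (τ.entry p).1 + m → f x ≤ f p := by
        intro m
        induction m with
        | zero => exact fun _ x hx => (congrArg f (τ.entry.injective (Fin.ext hx))).le
        | succ m ihm =>
          intro hm y hy
          have := (τ.entry y).2
          set x := τ.pos ⟨(τ.entry p).1 + m, by omega⟩ with hx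
          have hxe : (τ.entry x).1 = (τ.entry p).1 + m := by rw [hx, entry_pos]
          have h1 := ihm (by omega) x hxe
          by_contra! h2
          have h3 := (hstep x y (by omega) (by omega)).1
          have h4 := H y (by omega) (by omega) h2.le
          omega
      have := (τ.entry q).2
      set x := τ.pos ⟨(τ.entry p).1 + k, by omega⟩ with hx
      have hxe : (τ.entry x).1 = (τ.entry p).1 + k := by rw [hx, entry_pos]
      have h1 := hlow k le_rfl x hxe
      have h2 := (hstep x q (by omega) (by omega)).1
      have h3 := H x (by omega) (by omega) (by omega)
      omega
    have hpx : B p x := by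
      rcases h3.lt_or_eq with h | h
      · exact (ih ((τ.entry x).1 - (τ.entry p).1 - 1) (by omega) p x (by omega) h).1
      · exact heq p x h1 h
    have hxq : B x q := by
      rcases h4.lt_or_eq with h | h
      · exact (ih ((τ.entry q).1 - (τ.entry x).1 - 1) (by omega) x q (by omega) h).1
      · exact heq x q h2 h
    exact ⟨htrans _ _ _ hpx hxq, Or.inr ⟨x, hpx, hxq⟩⟩

/-- In a source tableau, an entry lying strictly left of a smaller one is forced to be larger in
the whole class; it is a forced successor only if it is the next entry. -/
theorem IsSource.below (hτ : τ.IsSource) {p q : Cell α} (hc : q.col < p.col)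
    (h : τ.entry p < τ.entry q) :
    Below τ p q ∧ ((τ.entry q).1 = (τ.entry p).1 + 1 ∨ ∃ x, Below τ p x ∧ Below τ x q) := by
  have h' : (τ.entry p).1 < (τ.entry q).1 := h
  have := τ.rel_of_height_lt (fun x => -(x.col : ℤ)) (Below τ) (fun _ _ _ => Below.trans)
    (fun x y h1 h2 => below_of_col_eq (by omega) h1) ?_ ((τ.entry q).1 - (τ.entry p).1 - 1) p q
    (by omega) (by omega)
  · exact ⟨this.1, this.2.imp_left fun _ => by omega⟩
  · intro x y hxy hf
    have hy := (τ.entry y).2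
    have hx : τ.pos (lo ⟨(τ.entry x).1, by omega⟩) = x := pos_eq rfl
    have hy : τ.pos (hi ⟨(τ.entry x).1, by omega⟩) = y := pos_eq (Fin.ext hxy)
    have hs := hτ ⟨(τ.entry x).1, by omega⟩ (by rw [mem_Des_iff, hx, hy]; omega)
    rw [hx, hy] at hs
    exact ⟨by omega, below_of_row_eq hs.1.symm (by omega)⟩

/-- In a sink tableau, an entry lying strictly left of a larger one is forced to be smaller in
the whole class. -/
theorem IsSink.below (hτ : τ.IsSink) {p q : Cell α} (hc : p.col < q.col)
    (h : τ.entry p < τ.entry q) : Below τ p q := by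
  have h' : (τ.entry p).1 < (τ.entry q).1 := h
  refine (τ.rel_of_height_lt (fun x => (x.col : ℤ)) (Below τ) (fun _ _ _ => Below.trans)
    (fun x y h1 h2 => below_of_col_eq (by omega) h1) ?_ ((τ.entry q).1 - (τ.entry p).1 - 1) p q
    (by omega) (by omega)).1
  intro x y hxy hf
  have hy := (τ.entry y).2
  have hx : τ.pos (lo ⟨(τ.entry x).1, by omega⟩) = x := pos_eq rfl
  have hy : τ.pos (hi ⟨(τ.entry x).1, by omega⟩) = y := pos_eq (Fin.ext hxy)
  have hs := hτ ⟨(τ.entry x).1, by omega⟩ (by rw [mem_Des_iff, hx, hy]; omega)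
  rw [hx, hy] at hs
  refine ⟨?_, below_of_attacks hs (by rw [Fin.lt_def]; omega)⟩
  rcases hs with hs | hs <;> omega

/-- The common order of a class is the intersection of the orders given by its source and its
sink. -/
theorem below_iff {τ τ' : SRCT α} (hcl : τ'.toClass = τ.toClass) (hs : τ.IsSource)
    (hk : τ'.IsSink) (p q : Cell α) :
    Below τ p q ↔ τ.entry p < τ.entry q ∧ τ'.entry p < τ'.entry q := by
  refine ⟨fun h => ⟨h τ rfl, h τ' hcl⟩, fun h => ?_⟩
  rcases lt_trichotomy p.col q.col with hc | hc | hc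
  · exact (below_congr hcl).1 (hk.below hc h.2)
  · exact below_of_col_eq hc h.1
  · exact (hs.below hc h.1).1

theorem eq_of_entry_lt {τ₁ τ₂ : SRCT α}
    (h : ∀ p q, τ₁.entry p < τ₁.entry q → τ₂.entry p < τ₂.entry q) : τ₁ = τ₂ := by
  have hm : StrictMono (fun v => τ₂.entry (τ₁.pos v)) := fun v w hvw => h _ _ (by
    rwa [entry_pos, entry_pos])
  have he := (hm.range_inj strictMono_id).1 (by
    rw [Set.range_id, Set.range_eq_univ]
    exact τ₂.entry.surjective.comp τ₁.entry.symm.surjective)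
  refine SRCT.ext (Equiv.ext fun p => ?_)
  have := congrFun he (τ₁.entry p)
  simp only [pos_eq rfl, id] at this
  exact this.symm

theorem IsSource.eq {τ₁ τ₂ : SRCT α} (h1 : τ₁.IsSource) (h2 : τ₂.IsSource)
    (hcl : τ₁.toClass = τ₂.toClass) : τ₁ = τ₂ := by
  refine eq_of_entry_lt fun p q h => ?_
  have hne : p ≠ q := by rintro rfl; exact lt_irrefl _ h
  rcases lt_trichotomy p.col q.col with hc | hc | hc
  · exact (τ₂.entry_lt_or_lt hne).resolve_right fun h' => ((h2.below hc h').1 τ₁ hcl).not_gt h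
  · exact below_of_col_eq hc h τ₂ hcl.symm
  · exact (h1.below hc h).1 τ₂ hcl.symm

theorem IsSink.eq {τ₁ τ₂ : SRCT α} (h1 : τ₁.IsSink) (h2 : τ₂.IsSink)
    (hcl : τ₁.toClass = τ₂.toClass) : τ₁ = τ₂ := by
  refine eq_of_entry_lt fun p q h => ?_
  have hne : p ≠ q := by rintro rfl; exact lt_irrefl _ h
  rcases lt_trichotomy p.col q.col with hc | hc | hc
  · exact h1.below hc h τ₂ hcl.symm
  · exact below_of_col_eq hc h τ₂ hcl.symm
  · exact (τ₂.entry_lt_or_lt hne).resolve_right fun h' => (h2.below hc h' τ₁ hcl).not_gt h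

/-- The enumeration of the boxes column by column. -/
noncomputable def colOrder (α : Composition n) : Fin n ≃ Cell α :=
  sortEquiv (fun p : Cell α => toLex (p.col, p.row))
    (fun _ _ h => Cell.ext_row_col (congrArg (fun x => (ofLex x).2) h)
      (congrArg (fun x => (ofLex x).1) h)) (Cell.card_eq α)

theorem colOrder_symm_lt {p q : Cell α} (h : p.col < q.col) :
    (colOrder α).symm p < (colOrder α).symm q := by
  have := key_sortEquiv_lt (n := n) (fun p : Cell α => toLex (p.col, p.row))
    (fun _ _ h => Cell.ext_row_col (congrArg (fun x => (ofLex x).2) h)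
      (congrArg (fun x => (ofLex x).1) h)) (Cell.card_eq α)
      ((colOrder α).symm p) ((colOrder α).symm q)
  refine this.1 ?_
  change toLex (((colOrder α) _).col, _) < toLex (((colOrder α) _).col, _)
  rw [Equiv.apply_symm_apply, Equiv.apply_symm_apply]
  exact Prod.Lex.toLex_lt_toLex.2 (Or.inl h)

/-- The column reading word of a filling. -/
noncomputable def colWord (e : Cell α ≃ Fin n) : Equiv.Perm (Fin n) := (colOrder α).trans e

/-- Exchanging `i` and `i + 1` when `i` lies strictly left of `i + 1` creates an inversion in the
column reading word. -/
theorem card_invSet_colWord_swapFill (e : Cell α ≃ Fin n) (i : Fin (n - 1))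
    (h : (e.symm (lo i)).col < (e.symm (hi i)).col) :
    (invSet (colWord (swapFill i e))).card = (invSet (colWord e)).card + 1 :=
  invSet_s_mul (colWord e) i (colOrder_symm_lt h)

instance : Finite (SRCT α) := Finite.of_injective entry entry_injective

theorem exists_isSink (E : EqClass α) : ∃ τ : SRCT α, τ.toClass = E ∧ τ.IsSink := by
  obtain ⟨τ₁, hτ₁⟩ := Quotient.exists_rep E
  obtain ⟨τ, hτ, hmax⟩ := Set.exists_max_image {τ : SRCT α | τ.toClass = E}
    (fun τ => (invSet (colWord τ.entry)).card) (Set.toFinite _) ⟨τ₁, hτ₁⟩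
  refine ⟨τ, hτ, fun i hd => by_contra fun ha => ?_⟩
  have h1 := hmax (τ.swap i hd ha) ((toClass_swap τ i hd ha).trans hτ)
  have hc := lt_of_le_of_ne ((mem_Des_iff τ i).1 hd) fun h => ha (Or.inl h)
  have h2 := card_invSet_colWord_swapFill τ.entry i hc
  have h3 : (τ.swap i hd ha).entry = swapFill i τ.entry := rfl
  rw [h3] at h1
  omega

theorem exists_isSource (E : EqClass α) : ∃ τ : SRCT α, τ.toClass = E ∧ τ.IsSource := by
  obtain ⟨τ₁, hτ₁⟩ := Quotient.exists_rep E
  obtain ⟨τ, hτ, hmin⟩ := Set.exists_min_image {τ : SRCT α | τ.toClass = E}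
    (fun τ => (invSet (colWord τ.entry)).card) (Set.toFinite _) ⟨τ₁, hτ₁⟩
  refine ⟨τ, hτ, fun i hd => ?_⟩
  have hc : (τ.pos (hi i)).col < (τ.pos (lo i)).col := by
    rw [mem_Des_iff] at hd
    omega
  by_cases hr : (τ.pos (hi i)).row = (τ.pos (lo i)).row
  · refine ⟨hr, ?_⟩
    by_contra hne
    -- A box of the row strictly between the two boxes would have an entry strictly between
    -- `i` and `i + 1`.
    obtain ⟨t, ht1, ht2⟩ : ∃ t : Cell α, t.row = (τ.pos (lo i)).row ∧
        t.col = (τ.pos (hi i)).col + 1 :=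
      ⟨⟨(τ.pos (lo i)).1, ⟨(τ.pos (hi i)).col + 1, by
        have := (τ.pos (lo i)).2.2
        unfold Cell.col at *
        omega⟩⟩, rfl, rfl⟩
    have h1 := τ.row_decreasing t (τ.pos (lo i)) ht1 (by omega)
    have h2 := τ.row_decreasing (τ.pos (hi i)) t (hr.trans ht1.symm) (by omega)
    rw [entry_pos, Fin.lt_def] at h1 h2
    simp only [lo, hi] at h1 h2
    omega
  · exfalso
    obtain ⟨τ₂, h1, h2⟩ := τ.exists_srct_of_fill (swapFill i τ.entry) (by
      intro p q hpq hlt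
      refine s_lt_s i hlt ?_
      rintro ⟨hp, hq⟩
      rw [← pos_eq hp, ← pos_eq hq] at hpq
      rcases hpq with (hpq | hpq) | hpq
      · omega
      · omega
      · exact hr hpq.1.symm)
    have h3 := hmin τ₂ (h2.trans hτ)
    have h4 := card_invSet_colWord_swapFill (swapFill i τ.entry) i (by
      rw [swapFill_symm, swapFill_symm, s_lo, s_hi]
      exact hc)
    have h5 : swapFill i (swapFill i τ.entry) = τ.entry :=
      Equiv.ext fun p => s_s i (τ.entry p)
    rw [h5] at h4
    rw [h1] at h3
    omega

end SRCT

namespace ZeroHeckeSet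

/-! ### Isomorphisms between modules with multiplicative bases -/

variable {X Y : Type} (A : ZeroHeckeSet n X) (B : ZeroHeckeSet n Y)

theorem map_smul_of_map_pi_smul (f : A.Mod →ₗ[ℂ] B.Mod)
    (hf : ∀ (i : Fin (n - 1)) m, f (HeckeZero.pi i • m) = HeckeZero.pi i • f m)
    (h : HeckeZero n) (m : A.Mod) :
    f (h • m) = h • f m := by
  obtain ⟨a, rfl⟩ := HeckeZero.mk_surjective n h
  induction a using FreeAlgebra.induction generalizing m with
  | grade0 c => rw [AlgHom.commutes, algebraMap_smul, algebraMap_smul, map_smul]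
  | grade1 i => exact hf i m
  | mul a b ha hb => rw [map_mul, mul_smul, mul_smul, ha, hb]
  | add a b ha hb => rw [map_add, add_smul, add_smul, map_add, ha, hb]

/-- The linear map sending basis elements to basis elements along `t`. -/
noncomputable def mapBasis (t : X → Y) : A.Mod →ₗ[ℂ] B.Mod := Finsupp.lmapDomain ℂ ℂ t

theorem mapBasis_basis (t : X → Y) (x : X) : A.mapBasis B t (A.basis x) = B.basis (t x) :=
  Finsupp.mapDomain_single

theorem mod_hom_ext {M : Type} [AddCommGroup M] [Module ℂ M] {f g : A.Mod →ₗ[ℂ] M}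
    (h : ∀ x, f (A.basis x) = g (A.basis x)) : f = g := by
  refine Finsupp.lhom_ext' (M := ℂ) fun x => LinearMap.ext_ring ?_
  exact h x

/-- An injection of multiplicative bases that is compatible with the actions identifies the module
of the source with the submodule spanned by the image. -/
theorem nonempty_spanSubmodule_equiv (t : X → Y) (ht : Function.Injective t)
    (hact : ∀ i x, B.act i (t x) = (A.act i x).map t) (U : Set Y)
    (hU : ∀ i, ∀ x ∈ U, ∀ y, B.act i x = some y → y ∈ U) (hr : Set.range t = U) :
    Nonempty (B.spanSubmodule U hU ≃ₗ[HeckeZero n] A.Mod) := by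
  let f := A.mapBasis B t
  have hpi : ∀ (i : Fin (n - 1)) m, f (HeckeZero.pi i • m) = HeckeZero.pi i • f m := by
    intro i m
    have : f ∘ₗ Module.toModuleEnd ℂ A.Mod (HeckeZero.pi i) =
        Module.toModuleEnd ℂ B.Mod (HeckeZero.pi i) ∘ₗ f := by
      refine A.mod_hom_ext fun x => ?_
      change f (HeckeZero.pi i • A.basis x) = HeckeZero.pi i • f (A.basis x)
      rw [pi_smul_basis, mapBasis_basis, pi_smul_basis, hact]
      cases A.act i x with
      | none => exact map_zero f
      | some y => exact A.mapBasis_basis B t y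
    exact LinearMap.congr_fun this m
  let g : A.Mod →ₗ[HeckeZero n] B.Mod :=
    { toFun := f, map_add' := map_add f, map_smul' := A.map_smul_of_map_pi_smul B f hpi }
  have hg : Function.Injective g := Finsupp.mapDomain_injective ht
  have hrange : LinearMap.range g = B.spanSubmodule U hU := by
    apply SetLike.coe_injective
    change Set.range f = (Submodule.span ℂ (B.basis '' U) : Set B.Mod)
    have htop : Submodule.span ℂ (Set.range A.basis) = ⊤ := by
      have := (Finsupp.basisSingleOne (R := ℂ) (ι := X)).span_eq
      rw [Finsupp.coe_basisSingleOne] at this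
      exact this
    rw [← LinearMap.coe_range, LinearMap.range_eq_map, ← htop, Submodule.map_span, ← Set.range_comp,
      ← hr, ← Set.range_comp]
    congr 3
    funext x
    exact A.mapBasis_basis B t x
  exact ⟨((LinearEquiv.ofInjective g hg).trans (LinearEquiv.ofEq _ _ hrange)).symm⟩

end ZeroHeckeSet

namespace SRCT

variable {α : Composition n} {τ τ₀ τ₁ : SRCT α}

/-! ### Reading words of a class -/

theorem strip_mono (τ : SRCT α) {p q : Cell α} (h : τ.entry p ≤ τ.entry q) :
    τ.strip p ≤ τ.strip q :=
  Finset.card_le_card fun i hi => by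
    rw [Finset.mem_filter] at hi ⊢
    exact ⟨hi.1, hi.2.trans_le h⟩

theorem strip_lt_iff (τ : SRCT α) (p q : Cell α) :
    τ.strip p < τ.strip q ↔
      (comp τ.Des).index (τ.entry p) < (comp τ.Des).index (τ.entry q) := by
  rw [index_lt_iff, setOf_comp]
  constructor
  · intro h
    by_contra hc
    refine h.not_ge (Finset.card_le_card fun i hi => ?_)
    rw [Finset.mem_filter] at hi ⊢
    refine ⟨hi.1, not_le.1 fun hle => hc ⟨i, hi.1, hle, hi.2⟩⟩
  · rintro ⟨i, hi, h1, h2⟩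
    apply Finset.card_lt_card
    rw [Finset.ssubset_iff_of_subset]
    · exact ⟨i, Finset.mem_filter.2 ⟨hi, h2⟩, fun h => (Finset.mem_filter.1 h).2.not_ge h1⟩
    · intro j hj
      rw [Finset.mem_filter] at hj ⊢
      exact ⟨hj.1, hj.2.trans_le (h1.trans h2.le)⟩

theorem entry_lt_iff (τ : SRCT α) (p q : Cell α) :
    τ.entry p < τ.entry q ↔
      τ.strip p < τ.strip q ∨ (τ.strip p = τ.strip q ∧ q.col < p.col) := by
  have key : ∀ p q, τ.entry p < τ.entry q → τ.strip p = τ.strip q → q.col < p.col := by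
    intro p q h h'
    have h1 : (τ.entry p).1 < (τ.entry q).1 := h
    exact τ.col_lt_of_strip_eq ((τ.entry q).1 - (τ.entry p).1 - 1) p q (by omega) h'
  constructor
  · intro h
    rcases (τ.strip_mono h.le).lt_or_eq with h1 | h1
    · exact Or.inl h1
    · exact Or.inr ⟨h1, key p q h h1⟩
  · rintro (h | ⟨h1, h2⟩)
    · exact not_le.1 fun h' => h.not_ge (τ.strip_mono h')
    · have hne : p ≠ q := by rintro rfl; exact lt_irrefl _ h2
      exact (τ.entry_lt_or_lt hne).resolve_right fun h => (key q p h h1.symm).not_gt h2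

theorem readOrder_symm_lt_iff (τ : SRCT α) (p q : Cell α) :
    τ.readOrder.symm p < τ.readOrder.symm q ↔
      τ.strip p < τ.strip q ∨ (τ.strip p = τ.strip q ∧ p.col < q.col) := by
  rw [← readKey_readOrder_lt, Equiv.apply_symm_apply, Equiv.apply_symm_apply]
  exact Prod.Lex.toLex_lt_toLex

theorem lt_iff_readOrder (τ : SRCT α) (a b : Fin n) :
    a < b ↔ τ.strip (τ.readOrder a) < τ.strip (τ.readOrder b) ∨
      (τ.strip (τ.readOrder a) = τ.strip (τ.readOrder b) ∧
        (τ.readOrder a).col < (τ.readOrder b).col) := by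
  rw [← readOrder_symm_lt_iff, Equiv.symm_apply_apply, Equiv.symm_apply_apply]

theorem read_apply (τ₀ τ : SRCT α) (a : Fin n) : τ₀.read τ a = τ.entry (τ₀.readOrder a) := rfl

theorem read_inv_apply (τ₀ τ : SRCT α) (v : Fin n) :
    (τ₀.read τ)⁻¹ v = τ₀.readOrder.symm (τ.pos v) := rfl

/-- The positions of a strip in the reading word are as a set the entries of the strip, as both
are enumerated by increasing strip. -/
theorem index_read (τ : SRCT α) (a : Fin n) :
    (comp τ.Des).index (τ.read τ a) = (comp τ.Des).index a := by
  have h1 : Monotone ((comp τ.Des).index ∘ τ.read τ) := by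
    intro a b hab
    by_contra hc
    have h := (τ.strip_lt_iff (τ.readOrder b) (τ.readOrder a)).2 (not_le.1 hc)
    exact ((τ.lt_iff_readOrder b a).2 (Or.inl h)).not_ge hab
  exact congrFun (Tuple.unique_monotone (τ := 1) h1 (index_monotone _)) a

theorem reversesBlocks_read (τ : SRCT α) : ReversesBlocks τ.Des (τ.read τ) := by
  intro a b
  have heq : τ.strip (τ.readOrder a) = τ.strip (τ.readOrder b) ↔
      (comp τ.Des).index a = (comp τ.Des).index b := by
    rw [← index_read τ a, ← index_read τ b]
    simp only [eq_iff_le_not_lt, ← not_lt, read_apply, ← strip_lt_iff]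
  have hlt : ∀ a b, τ.strip (τ.readOrder a) < τ.strip (τ.readOrder b) ↔
      (comp τ.Des).index a < (comp τ.Des).index b := by
    intro a b
    rw [← index_read τ a, ← index_read τ b, strip_lt_iff, read_apply, read_apply]
  rw [read_apply, read_apply, entry_lt_iff, hlt, heq]
  refine or_congr_right (and_congr_right fun h => ?_)
  rw [τ.lt_iff_readOrder b a, hlt, h, heq.2 h]
  simp

section Class

variable {τ τ₀ τ' : SRCT α}

theorem invSet_read_subset (hs : τ₀.IsSource) (hcl : τ.toClass = τ₀.toClass) :
    invSet (τ₀.read τ₀) ⊆ invSet (τ₀.read τ) := by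
  rintro ⟨a, b⟩ hab
  rw [mem_invSet] at hab ⊢
  refine ⟨hab.1, ?_⟩
  rw [lt_iff_readOrder τ₀, read_apply, read_apply, entry_lt_iff] at hab
  exact (hs.below (by omega) ((entry_lt_iff _ _ _).2 hab.2)).1 τ hcl

theorem mem_leftInterval_read_iff (hs : τ₀.IsSource) (hcl : τ'.toClass = τ₀.toClass)
    (hk : τ'.IsSink) (γ : Equiv.Perm (Fin n)) :
    γ ∈ leftInterval (τ₀.read τ₀) (τ₀.read τ') ↔
      ∀ p q, Below τ₀ p q → γ (τ₀.readOrder.symm p) < γ (τ₀.readOrder.symm q) := by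
  rw [mem_leftInterval_iff (invSet_read_subset hs hcl)]
  simp only [below_iff hcl hs hk, read_apply, and_imp]
  constructor
  · intro h p q h1 h2
    refine h _ _ ?_ ?_ <;> simpa
  · intro h a b h1 h2
    simpa using h _ _ h1 h2

theorem read_mem_leftInterval (hs : τ₀.IsSource) (hcl : τ'.toClass = τ₀.toClass)
    (hk : τ'.IsSink) (h : τ.toClass = τ₀.toClass) :
    τ₀.read τ ∈ leftInterval (τ₀.read τ₀) (τ₀.read τ') := by
  rw [mem_leftInterval_read_iff hs hcl hk]
  intro p q hpq
  simpa [read_apply] using hpq τ h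

theorem exists_read_eq (hs : τ₀.IsSource) (hcl : τ'.toClass = τ₀.toClass) (hk : τ'.IsSink)
    {γ : Equiv.Perm (Fin n)} (hγ : γ ∈ leftInterval (τ₀.read τ₀) (τ₀.read τ')) :
    ∃ τ : SRCT α, τ₀.read τ = γ ∧ τ.toClass = τ₀.toClass := by
  rw [mem_leftInterval_read_iff hs hcl hk] at hγ
  obtain ⟨τ, h1, h2⟩ := τ₀.exists_srct_of_below (τ₀.readOrder.symm.trans γ) hγ
  refine ⟨τ, Equiv.ext fun a => ?_, h2⟩
  rw [read_apply, h1]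
  simp

theorem read_injective (τ₀ : SRCT α) : Function.Injective τ₀.read := by
  intro τ₁ τ₂ h
  refine SRCT.ext (Equiv.ext fun p => ?_)
  simpa [read_apply] using DFunLike.congr_fun h (τ₀.readOrder.symm p)

/-- The left descents of the reading word of `τ` are the indices that are not descents of `τ`. -/
theorem mem_desL_read_iff (hs : τ₀.IsSource) (hcl : τ.toClass = τ₀.toClass) (i : Fin (n - 1)) :
    i ∈ desL (τ₀.read τ) ↔ i ∉ τ.Des := by
  rw [mem_desL_iff, read_inv_apply, read_inv_apply, mem_Des_iff]
  have hlt : τ.entry (τ.pos (lo i)) < τ.entry (τ.pos (hi i)) := by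
    rw [entry_pos, entry_pos]
    exact lo_lt_hi i
  have hnext : ¬ ∃ x, Below τ₀ (τ.pos (lo i)) x ∧ Below τ₀ x (τ.pos (hi i)) := by
    rintro ⟨x, h1, h2⟩
    have h1 := h1 τ hcl
    have h2 := h2 τ hcl
    rw [entry_pos, Fin.lt_def] at h1 h2
    simp only [lo, hi] at h1 h2
    omega
  set p := τ.pos (lo i)
  set q := τ.pos (hi i)
  have hne : p ≠ q := by
    intro e
    rw [e] at hlt
    exact lt_irrefl _ hlt
  constructor
  · intro h hc
    rw [readOrder_symm_lt_iff] at h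
    rcases h with h | h
    · have h' : τ₀.entry q < τ₀.entry p := (entry_lt_iff _ _ _).2 (Or.inl h)
      rcases hc.lt_or_eq with hc | hc
      · exact ((hs.below hc h').1 τ hcl).not_gt hlt
      · exact (below_of_col_eq hc.symm h' τ hcl).not_gt hlt
    · exact hc.not_gt h.2
  · intro hc
    have hc := not_le.1 hc
    rw [readOrder_symm_lt_iff]
    rcases τ₀.entry_lt_or_lt hne with h | h
    · -- Here `q` lies left of `p` and no box is forced to lie between them, so that they carry
      -- consecutive entries of the source, the first of which is not a descent. Hence the two
      -- boxes belong to the same strip.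
      have h1 := (hs.below hc h).2.resolve_right hnext
      refine Or.inr ⟨?_, hc⟩
      refine le_antisymm (not_lt.1 fun h2 => ?_) (τ₀.strip_mono h.le)
      rw [strip_lt_iff, index_lt_iff, setOf_comp] at h2
      obtain ⟨j, hj, hj1, hj2⟩ := h2
      rw [mem_Des_iff, pos_eq (p := p) (Fin.ext (by simp only [lo]; omega)),
        pos_eq (p := q) (Fin.ext (by simp only [hi]; omega))] at hj
      exact hj.not_gt hc
    · rcases (entry_lt_iff _ _ _).1 h with h | h
      · exact Or.inl h
      · exact absurd h.2 hc.not_gt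

/-- Under the reading word, the action on the class is the action on the left weak order
interval. -/
theorem act_eq_map_intervalAct (hs : τ₀.IsSource) (hcl : τ'.toClass = τ₀.toClass)
    (hk : τ'.IsSink) (t : ↥(leftInterval (τ₀.read τ₀) (τ₀.read τ')) → SRCT α)
    (ht : ∀ γ, τ₀.read (t γ) = γ.1) (htc : ∀ γ, (t γ).toClass = τ₀.toClass) (i : Fin (n - 1))
    (γ : ↥(leftInterval (τ₀.read τ₀) (τ₀.read τ'))) :
    act i (t γ) = (intervalAct (τ₀.read τ₀) (τ₀.read τ') i γ).map t := by
  have hd := mem_desL_read_iff hs (htc γ) i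
  rw [ht] at hd
  unfold act intervalAct
  by_cases h1 : i ∈ (t γ).Des
  · rw [dif_pos h1, if_neg fun h => hd.1 h h1]
    have hread : ∀ a, (s i * γ.1) a = s i ((t γ).entry (τ₀.readOrder a)) := fun a => by
      rw [Equiv.Perm.mul_apply, ← ht, read_apply]
    by_cases h2 : Attacks ((t γ).pos (lo i)) ((t γ).pos (hi i))
    · rw [dif_pos h2, dif_neg]
      · rfl
      · intro h3
        rw [mem_leftInterval_read_iff hs hcl hk] at h3
        have h4 := h3 _ _ ((below_congr (htc γ)).1 (below_of_attacks h2 (by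
          rw [entry_pos, entry_pos]
          exact lo_lt_hi i)))
        rw [hread, hread, Equiv.apply_symm_apply, Equiv.apply_symm_apply, entry_pos, entry_pos,
          s_lo, s_hi] at h4
        exact h4.not_gt (lo_lt_hi i)
    · have h3 : τ₀.read ((t γ).swap i h1 h2) = s i * γ.1 := Equiv.ext fun a => (hread a).symm
      have h4 : s i * γ.1 ∈ leftInterval (τ₀.read τ₀) (τ₀.read τ') :=
        h3 ▸ read_mem_leftInterval hs hcl hk ((toClass_swap _ _ _ _).trans (htc γ))
      rw [dif_neg h2, dif_pos h4, Option.map_some]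
      exact congrArg some (τ₀.read_injective (h3.trans (ht ⟨_, h4⟩).symm))
  · rw [dif_neg h1, if_pos (hd.2 h1), Option.map_some]

theorem nonempty_moduleSE_equiv_BL (hs : τ₀.IsSource) (hcl : τ'.toClass = τ₀.toClass)
    (hk : τ'.IsSink) :
    Nonempty (moduleSE α τ₀.toClass ≃ₗ[HeckeZero n] BL (τ₀.read τ₀) (τ₀.read τ')) := by
  choose t ht htc using fun γ : ↥(leftInterval (τ₀.read τ₀) (τ₀.read τ')) =>
    exists_read_eq hs hcl hk γ.2
  refine (intervalSet _ _).nonempty_spanSubmodule_equiv (heckeSet α) t ?_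
    (act_eq_map_intervalAct hs hcl hk t ht htc) _ _ ?_
  · intro γ γ' h
    exact Subtype.ext (by rw [← ht, ← ht, h])
  · ext τ
    constructor
    · rintro ⟨γ, rfl⟩
      exact htc γ
    · intro h
      exact ⟨⟨_, read_mem_leftInterval hs hcl hk h⟩, τ₀.read_injective (ht _)⟩

end Class
end SRCT

end HeckePoset

theorem mainTheorem8 (n : ℕ) (α : Composition n) (E : HeckePoset.SRCT.EqClass α) :
    (∃! τ : HeckePoset.SRCT α, τ.toClass = E ∧ τ.IsSource) ∧
    (∃! τ' : HeckePoset.SRCT α, τ'.toClass = E ∧ τ'.IsSink) ∧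
    ∀ τ τ' : HeckePoset.SRCT α, τ.toClass = E → τ.IsSource → τ'.toClass = E → τ'.IsSink →
      HeckePoset.LeftWeakLE (τ.read τ) (τ.read τ') ∧
      Nonempty (HeckePoset.SRCT.moduleSE α E ≃ₗ[HeckePoset.HeckeZero n]
        HeckePoset.BL (τ.read τ) (τ.read τ')) ∧
      ∃ hD : HeckePoset.IsDiagram n
          (HeckePoset.diagram (HeckePoset.comp τ.Desᶜ) (τ.read τ')),
        ∀ P : PartialOrder (Fin n),
          HeckePoset.linExtR P = HeckePoset.rightInterval
              (HeckePoset.w0 * (τ.read τ')⁻¹) (HeckePoset.w0 * (τ.read τ)⁻¹) ↔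
            P = HeckePoset.canonicalPoset
              (HeckePoset.diagram (HeckePoset.comp τ.Desᶜ) (τ.read τ')) hD := by
  open HeckePoset in
  refine ⟨?_, ?_, ?_⟩
  · obtain ⟨τ, h1, h2⟩ := SRCT.exists_isSource E
    exact ⟨τ, ⟨h1, h2⟩, fun τ₁ h => h.2.eq h2 (h.1.trans h1.symm)⟩
  · obtain ⟨τ, h1, h2⟩ := SRCT.exists_isSink E
    exact ⟨τ, ⟨h1, h2⟩, fun τ₁ h => h.2.eq h2 (h.1.trans h1.symm)⟩
  · rintro τ τ' rfl hs hcl hk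
    have hsub := SRCT.invSet_read_subset hs hcl
    have hrev := τ.reversesBlocks_read
    have hD := hrev.isDiagram hsub
    refine ⟨leftWeakLE_iff.2 hsub, SRCT.nonempty_moduleSE_equiv_BL hs hcl hk, hD, fun P => ?_⟩
    rw [← hrev.linExtR_canonicalPoset hsub hD]
    exact linExtR_injective.eq_iff
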